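/- For real $k$ let $V_k(u)=\frac14 e^{2u}+k e^{u}$ be the Morse potential. For real $u_0,k,\alpha$ consider the operator $H=-\frac{d^2}{du^2}+V_k(u)$ in $L^2([u_0,\infty);du)$ with boundary condition $$(\cos\alpha)\,\psi(u_0)+(\sin\alpha)\,\psi'(u_0)=0 .$$ Its domain consists of all complex-valued $\psi\in C^1[u_0,\infty)\cap L^2([u_0,\infty);du)$ satisfying the boundary condition, such that $\psi'$ is absolutely continuous on every $[u_0,b]$ and $\psi''$ and $-\psi''+V_k\psi$ belong to $L^2([u_0,\infty);du)$. Fix $\alpha\in\mathbb{R}$ and an integer $n\ge 0$. Then, for all real $u_0$ and $k$, the operator has an $n$-th eigenvalue from the bottom, that is, a (necessarily unique) real eigenvalue $E_{n,\alpha}(u_0,k)$ with exactly $n$ distinct eigenvalues below it. Moreover: (i) For each fixed $k\ge 0$, $E_{n,\alpha}(u_0,k)$ is a strictly increasing function of $u_0\in\mathbb{R}$. (ii) For each fixed $k<0$, $E_{n,\alpha}(u_0,k)$ is a strictly increasing function of $u_0$ on the interval $u_0\ge \log(2|k|)$. (iii) For each fixed $u_0\in\mathbb{R}$, $E_{n,\alpha}(u_0,k)$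 is a strictly increasing function of $k\in\mathbb{R}$. -/

import Mathlib

open MeasureTheory Set

noncomputable section

/-- The Morse potential `V_k(u) = e^{2u}/4 + k e^u`. -/
def morsePotential (k u : ℝ) : ℝ :=
  (1 / 4) * Real.exp (2 * u) + k * Real.exp u

/-- The derivative `f'` of a function on the half-line `[u₀, ∞)` (one-sided at `u₀`). -/
def halfLineDeriv (u₀ : ℝ) (f : ℝ → ℂ) : ℝ → ℂ :=
  derivWithin f (Ici u₀)

/-- `f ∈ L²([u₀, ∞); du)`. -/
def IsHalfLineL2 (u₀ : ℝ) (f : ℝ → ℂ) : Prop :=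
  MemLp f 2 (volume.restrict (Ici u₀))

/-- The differential expression `-f'' + V_k f` on `[u₀, ∞)`. -/
def morseExpr (u₀ k : ℝ) (f : ℝ → ℂ) : ℝ → ℂ :=
  fun u => -(halfLineDeriv u₀ (halfLineDeriv u₀ f) u) + (morsePotential k u : ℂ) * f u

/-- The domain of the self-adjoint operator `H = -d²/du² + V_k` in `L²([u₀, ∞); du)` with
boundary condition `(cos α) f(u₀) + (sin α) f'(u₀) = 0`. Only the values of `f` on `[u₀, ∞)`
matter. -/
structure InMorseDomain (α u₀ k : ℝ) (f : ℝ → ℂ) : Prop where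
  contDiffOn : ContDiffOn ℝ 1 f (Ici u₀)
  memL2 : IsHalfLineL2 u₀ f
  deriv_ac : ∀ b, u₀ ≤ b → AbsolutelyContinuousOnInterval (halfLineDeriv u₀ f) u₀ b
  deriv2_memL2 : IsHalfLineL2 u₀ (halfLineDeriv u₀ (halfLineDeriv u₀ f))
  expr_memL2 : IsHalfLineL2 u₀ (morseExpr u₀ k f)
  boundary : (Real.cos α : ℂ) * f u₀ + (Real.sin α : ℂ) * halfLineDeriv u₀ f u₀ = 0

/-- `E` is an eigenvalue of `H`: some `f` in the domain, nonzero in `L²([u₀, ∞); du)`, satisfies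
`H f = E f` in `L²([u₀, ∞); du)`. -/
def IsMorseEigenvalue (α u₀ k E : ℝ) : Prop :=
  ∃ f : ℝ → ℂ, InMorseDomain α u₀ k f ∧
    ¬ (f =ᵐ[volume.restrict (Ici u₀)] 0) ∧
    morseExpr u₀ k f =ᵐ[volume.restrict (Ici u₀)] fun u => (E : ℂ) * f u

/-- `E` is the `n`-th eigenvalue of `H` from the bottom, counting from `n = 0`: it is an
eigenvalue, and there are exactly `n` eigenvalues strictly below it. -/
def IsNthMorseEigenvalue (α : ℝ) (n : ℕ) (u₀ k E : ℝ) : Prop :=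
  IsMorseEigenvalue α u₀ k E ∧ {E' : ℝ | IsMorseEigenvalue α u₀ k E' ∧ E' < E}.encard = n

/-- The `n`-th eigenvalue `E_{n,α}(u₀, k)`. There is at most one `E` satisfying
`IsNthMorseEigenvalue α n u₀ k E`, so that the infimum just selects it. -/
def morseEigenvalue (α : ℝ) (n : ℕ) (u₀ k : ℝ) : ℝ :=
  sInf {E : ℝ | IsNthMorseEigenvalue α n u₀ k E}

/-- There is at most one `n`-th eigenvalue. -/
theorem IsNthMorseEigenvalue.unique {α : ℝ} {n : ℕ} {u₀ k E₁ E₂ : ℝ}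
    (h₁ : IsNthMorseEigenvalue α n u₀ k E₁) (h₂ : IsNthMorseEigenvalue α n u₀ k E₂) :
    E₁ = E₂ := by
  have key : ∀ {A B : ℝ}, IsNthMorseEigenvalue α n u₀ k A → IsNthMorseEigenvalue α n u₀ k B →
      ¬ A < B := by
    intro A B hA hB hlt
    have hfin : {E' : ℝ | IsMorseEigenvalue α u₀ k E' ∧ E' < A}.Finite :=
      Set.finite_of_encard_eq_coe hA.2
    have hss : {E' : ℝ | IsMorseEigenvalue α u₀ k E' ∧ E' < A} ⊂
        {E' : ℝ | IsMorseEigenvalue α u₀ k E' ∧ E' < B} :=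
      ⟨fun x hx => ⟨hx.1, hx.2.trans hlt⟩, fun h => lt_irrefl A (h ⟨hA.1, hlt⟩).2⟩
    have := hfin.encard_lt_encard hss
    rw [hA.2, hB.2] at this
    exact lt_irrefl _ this
  exact le_antisymm (not_lt.1 (key h₂ h₁)) (not_lt.1 (key h₁ h₂))

/-- The infimum in the definition of `morseEigenvalue` selects the `n`-th eigenvalue. -/
theorem IsNthMorseEigenvalue.eq_morseEigenvalue {α : ℝ} {n : ℕ} {u₀ k E : ℝ}
    (h : IsNthMorseEigenvalue α n u₀ k E) : morseEigenvalue α n u₀ k = E := by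
  have : {E' : ℝ | IsNthMorseEigenvalue α n u₀ k E'} = {E} :=
    Set.eq_singleton_iff_unique_mem.2 ⟨h, fun _ h' => h'.unique h⟩
  rw [morseEigenvalue, this, csInf_singleton]

end

/-! Translating the endpoint to 0 turns the problem into `-f'' + q f = e f` on [0, ∞) with q(x) =
V_k(u₀ + x) and a boundary condition independent of u₀ and k. Raising k, or raising u₀ where V_k
increases, raises q at every x > 0, so all three claims reduce to strict monotonicity of the
eigenvalues in q.

The eigenvalues are found by oscillation theory. Write f = r sin θ, f' = r cos θ. The Prüfer angle θ
crosses multiples of π only upwards and, where q > e, odd multiples of π/2 only downwards. Since q →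
∞, there are two cases. Either f f' < 0 eventually and f decays faster than any exponential
(`exists_sq_le_exp`), or f² is eventually bounded away from 0 (`exists_le_sq`). So e is an
eigenvalue exactly when θ ends in some sector (jπ - π/2, jπ) with j ≥ 1.

By Sturm comparison (`IsPruferAngle.lt_of_lt`) θ increases with e. The n-th level is the infimum of
the e whose angle somewhere exceeds (n + 1)π; there θ settles in the sector j = n + 1
(`eventuallyInSector_sturmLevel`). Two strictly ordered potentials cannot both settle in the same
sector (`not_eventuallyInSector_of_lt`), which makes the level of a sector unique and the
monotonicity strict. `isMorseEigenvalue_iff` identifies levels with eigenvalues. -/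

/-! ### Global existence of the Prüfer angle -/

/-- `θ` is the Prüfer angle of the equation `-f'' + p f = 0`, that is, `f = r sin θ` and
`f' = r cos θ`, with initial value `t₀` at `0`. -/
def IsPruferAngle (p : ℝ → ℝ) (t₀ : ℝ) (θ : ℝ → ℝ) : Prop :=
  θ 0 = t₀ ∧ ∀ x, HasDerivAt θ (1 - (1 + p x) * Real.sin (θ x) ^ 2) x

theorem sin_sq_sub_sin_sq (a b : ℝ) :
    Real.sin a ^ 2 - Real.sin b ^ 2 = Real.sin (a - b) * Real.sin (a + b) := by
  rw [Real.sin_sub, Real.sin_add]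
  have ha := Real.sin_sq_add_cos_sq a
  have hb := Real.sin_sq_add_cos_sq b
  linear_combination (Real.sin b ^ 2) * ha - (Real.sin a ^ 2) * hb

theorem abs_sin_sq_sub_sin_sq_le (a b : ℝ) :
    |Real.sin a ^ 2 - Real.sin b ^ 2| ≤ |a - b| := by
  rw [sin_sq_sub_sin_sq, abs_mul]
  calc |Real.sin (a - b)| * |Real.sin (a + b)| ≤ |a - b| * 1 :=
        mul_le_mul Real.abs_sin_le_abs (Real.abs_sin_le_one _) (abs_nonneg _) (abs_nonneg _)
    _ = |a - b| := mul_one _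

theorem lipschitzWith_pruferField {c : ℝ} {K : NNReal} (h : |1 + c| ≤ K) :
    LipschitzWith K fun y => 1 - (1 + c) * Real.sin y ^ 2 := by
  refine LipschitzWith.of_dist_le_mul fun a b => ?_
  rw [Real.dist_eq, Real.dist_eq]
  have : 1 - (1 + c) * Real.sin a ^ 2 - (1 - (1 + c) * Real.sin b ^ 2)
      = -((1 + c) * (Real.sin a ^ 2 - Real.sin b ^ 2)) := by ring
  rw [this, abs_neg, abs_mul]
  exact mul_le_mul h (abs_sin_sq_sub_sin_sq_le a b) (abs_nonneg _) K.2

theorem exists_bound_Icc {p : ℝ → ℝ} (hp : Continuous p) (a b : ℝ) :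
    ∃ K : NNReal, ∀ x ∈ Icc a b, |1 + p x| ≤ K := by
  obtain ⟨C, hC⟩ := isCompact_Icc.exists_bound_of_continuousOn
    (f := fun x => 1 + p x) (s := Icc a b) (by fun_prop)
  exact ⟨C.toNNReal, fun x hx => (hC x hx).trans (Real.le_coe_toNNReal C)⟩

/-- On [-b, b] the field is bounded by 1 + K for all values of the angle, so Picard–Lindelöf applies
on the whole interval with a ball of radius (1 + K)b. -/
theorem exists_pruferAngle_Ioo {p : ℝ → ℝ} (hp : Continuous p) (t₀ : ℝ) {b : ℝ} (hb : 0 < b) :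
    ∃ θ : ℝ → ℝ, θ 0 = t₀ ∧
      ∀ x ∈ Ioo (-b) b, HasDerivAt θ (1 - (1 + p x) * Real.sin (θ x) ^ 2) x := by
  obtain ⟨K, hK⟩ := exists_bound_Icc hp (-b) b
  have h0 : (0 : ℝ) ∈ Icc (-b) b := ⟨by linarith, hb.le⟩
  have hPL : IsPicardLindelof (fun x y => 1 - (1 + p x) * Real.sin y ^ 2)
      (⟨0, h0⟩ : Icc (-b) b) t₀ ((1 + K) * b.toNNReal) 0 (1 + K) K := by
    refine ⟨fun x hx => (lipschitzWith_pruferField (hK x hx)).lipschitzOnWith, fun y _ => by fun_prop,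
      fun x hx y _ => ?_, ?_⟩
    · have h1 := hK x hx
      have h2 : |(1 + p x) * Real.sin y ^ 2| ≤ (K : ℝ) := by
        rw [abs_mul, abs_of_nonneg (sq_nonneg (Real.sin y))]
        calc |1 + p x| * Real.sin y ^ 2 ≤ K * 1 :=
              mul_le_mul h1 (Real.sin_sq_le_one y) (sq_nonneg _) K.2
          _ = K := mul_one _
      rw [Real.norm_eq_abs]
      push_cast
      exact (abs_sub _ _).trans (by rw [abs_one]; linarith)
    · simp [Real.coe_toNNReal b hb.le]
  obtain ⟨θ, hθ0, hθ⟩ := hPL.exists_eq_forall_mem_Icc_hasDerivWithinAt₀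
  exact ⟨θ, hθ0, fun x hx => (hθ x (Ioo_subset_Icc_self hx)).hasDerivAt (Icc_mem_nhds hx.1 hx.2)⟩

theorem exists_isPruferAngle {p : ℝ → ℝ} (hp : Continuous p) (t₀ : ℝ) :
    ∃ θ, IsPruferAngle p t₀ θ := by
  choose α hα0 hα using fun n : ℕ => exists_pruferAngle_Ioo hp t₀ (b := (n : ℝ) + 1) (by positivity)
  have heq : ∀ n m : ℕ, n ≤ m → EqOn (α n) (α m) (Ioo (-((n : ℝ) + 1)) (n + 1)) := by
    intro n m hnm
    have hnm' : (n : ℝ) ≤ m := by exact_mod_cast hnm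
    obtain ⟨K, hK⟩ := exists_bound_Icc hp (-((n : ℝ) + 1)) (n + 1)
    have hn : (0 : ℝ) < n + 1 := by positivity
    refine ODE_solution_unique_of_mem_Ioo (t₀ := 0) (s := fun _ => univ) (K := K)
      (v := fun x y => 1 - (1 + p x) * Real.sin y ^ 2)
      (fun x hx => (lipschitzWith_pruferField (hK x (Ioo_subset_Icc_self hx))).lipschitzOnWith)
      ⟨by linarith, hn⟩ (fun x hx => ⟨hα n x hx, trivial⟩)
      (fun x hx => ⟨hα m x ⟨by linarith [hx.1], by linarith [hx.2]⟩, trivial⟩) ?_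
    rw [hα0, hα0]
  refine ⟨fun x => α ⌈|x|⌉₊ x, by simp [hα0], fun x => ?_⟩
  -- Near x the index ⌈|y|⌉ may jump, but all the branches involved agree with the single branch of
  -- index ⌈|x|⌉ + 1.
  have key : ∀ y : ℝ, |y| < ⌈|x|⌉₊ + 1 → α ⌈|y|⌉₊ y = α (⌈|x|⌉₊ + 1) y := by
    intro y hy
    refine heq _ _ (Nat.ceil_le.2 (by push_cast; exact hy.le)) ?_
    have h1 := Nat.le_ceil |y|
    exact abs_lt.1 (by linarith)
  have hx := Nat.le_ceil |x|
  have hev : (fun y => α ⌈|y|⌉₊ y) =ᶠ[nhds x] α (⌈|x|⌉₊ + 1) := by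
    have : ∀ᶠ y in nhds x, |y| < (⌈|x|⌉₊ : ℝ) + 1 :=
      continuous_abs.continuousAt.eventually_lt continuousAt_const (by linarith)
    exact this.mono key
  have hd := hα (⌈|x|⌉₊ + 1) x (abs_lt.1 (by push_cast; linarith))
  have hx' := key x (by linarith)
  refine (hd.congr_of_eventuallyEq hev).congr_deriv ?_
  simp only [hx']

open Classical in
/-- The Prüfer angle of `-f'' + p f = 0` with initial value `t₀` at `0`. -/
noncomputable def pruferAngle (p : ℝ → ℝ) (t₀ : ℝ) : ℝ → ℝ :=
  if h : ∃ θ, IsPruferAngle p t₀ θ then h.choose else 0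

theorem isPruferAngle_pruferAngle {p : ℝ → ℝ} (hp : Continuous p) (t₀ : ℝ) :
    IsPruferAngle p t₀ (pruferAngle p t₀) := by
  have h := exists_isPruferAngle hp t₀
  rw [pruferAngle, dif_pos h]
  exact h.choose_spec

theorem IsPruferAngle.continuous {p θ : ℝ → ℝ} {t₀ : ℝ} (h : IsPruferAngle p t₀ θ) :
    Continuous θ :=
  continuous_iff_continuousAt.2 fun x => (h.2 x).continuousAt

/-! ### Barriers, Sturm comparison and dependence on the spectral parameter -/

/-- A function whose derivative is positive wherever it takes the value `c` crosses `c` only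
upwards. -/
theorem lt_of_deriv_pos_of_eq {θ θ' : ℝ → ℝ} (hd : ∀ x, HasDerivAt θ (θ' x) x) {a c : ℝ}
    (ha : c ≤ θ a) (hb : ∀ x, a ≤ x → θ x = c → 0 < θ' x) {x : ℝ} (hx : a < x) : c < θ x := by
  have hle : ∀ y, a ≤ y → c ≤ θ y := by
    intro y hy
    have := image_le_of_deriv_right_lt_deriv_boundary (f := fun x => -θ x) (f' := fun x => -θ' x)
      (a := a) (b := y) (B := fun _ => -c) (B' := fun _ => 0)
      (fun x _ => (hd x).neg.continuousAt.continuousWithinAt)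
      (fun x _ => (hd x).neg.hasDerivWithinAt) (by simpa using ha)
      (fun x => hasDerivAt_const x _)
      (fun x hx h => by simpa using hb x hx.1 (by simpa using h)) ⟨hy, le_rfl⟩
    simpa using this
  refine lt_of_le_of_ne (hle x hx.le) fun heq => ?_
  have h1 : Filter.Tendsto (slope θ x) (nhdsWithin x (Iio x)) (nhds (θ' x)) :=
    (hasDerivAt_iff_tendsto_slope.1 (hd x)).mono_left
      (nhdsWithin_mono x fun y (hy : y < x) => hy.ne)
  have h2 : θ' x ≤ 0 := by
    refine le_of_tendsto h1 ?_
    filter_upwards [Ico_mem_nhdsLT hx] with y hy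
    rw [slope_def_field]
    exact div_nonpos_of_nonneg_of_nonpos (by linarith [hle y hy.1]) (by linarith [hy.2])
  exact absurd (hb x hx.le heq.symm) (not_lt.2 h2)

theorem lt_of_deriv_neg_of_eq {θ θ' : ℝ → ℝ} (hd : ∀ x, HasDerivAt θ (θ' x) x) {a c : ℝ}
    (ha : θ a ≤ c) (hb : ∀ x, a ≤ x → θ x = c → θ' x < 0) {x : ℝ} (hx : a < x) : θ x < c := by
  have := lt_of_deriv_pos_of_eq (θ := fun x => -θ x) (θ' := fun x => -θ' x) (c := -c)
    (fun x => (hd x).neg) (neg_le_neg ha)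
    (fun x hx h => by simpa using hb x hx (by simpa using h)) hx
  simpa using this

/-- At multiples of π the sine vanishes, so θ' = 1 whatever the potential is. -/
theorem IsPruferAngle.lt_of_le {p θ : ℝ → ℝ} {t₀ : ℝ} (h : IsPruferAngle p t₀ θ) (j : ℕ)
    {a x : ℝ} (ha : j * Real.pi ≤ θ a) (hx : a < x) : j * Real.pi < θ x :=
  lt_of_deriv_pos_of_eq h.2 ha (fun y _ hy => by rw [hy, Real.sin_nat_mul_pi]; norm_num) hx

theorem sin_sq_nat_mul_pi_sub (j : ℕ) (t : ℝ) :
    Real.sin (j * Real.pi - t) ^ 2 = Real.sin t ^ 2 := by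
  rw [Real.sin_nat_mul_pi_sub, neg_sq, mul_pow, ← pow_mul, mul_comm j 2, pow_mul]
  norm_num

/-- At odd multiples of π/2 one has sin² = 1, so θ' = -p < 0. -/
theorem IsPruferAngle.lt_of_pos {p θ : ℝ → ℝ} {t₀ : ℝ} (h : IsPruferAngle p t₀ θ) (j : ℕ)
    {a x : ℝ} (hp : ∀ y, a ≤ y → 0 < p y) (ha : θ a ≤ j * Real.pi - Real.pi / 2) (hx : a < x) :
    θ x < j * Real.pi - Real.pi / 2 :=
  lt_of_deriv_neg_of_eq h.2 ha (fun y hy hy' => by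
    rw [hy', sin_sq_nat_mul_pi_sub, Real.sin_pi_div_two]; linarith [hp y hy]) hx

theorem hasDerivAt_exp_neg_integral_mul {d g h : ℝ → ℝ} (hg : Continuous g) {x : ℝ}
    (hd : HasDerivAt d (h x + g x * d x) x) :
    HasDerivAt (fun x => Real.exp (-∫ t in (0 : ℝ)..x, g t) * d x)
      (Real.exp (-∫ t in (0 : ℝ)..x, g t) * h x) x := by
  have hG : HasDerivAt (fun x => ∫ t in (0 : ℝ)..x, g t) (g x) x :=
    intervalIntegral.integral_hasDerivAt_right (hg.intervalIntegrable _ _)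
      (hg.stronglyMeasurableAtFilter _ _) hg.continuousAt
  exact (hG.neg.exp.mul hd).congr_deriv (by simp only [Pi.neg_apply]; ring)

theorem IsPruferAngle.hasDerivAt_sub {p₁ p₂ θ₁ θ₂ : ℝ → ℝ} {t₁ t₂ : ℝ}
    (h₁ : IsPruferAngle p₁ t₁ θ₁) (h₂ : IsPruferAngle p₂ t₂ θ₂) (x : ℝ) :
    HasDerivAt (fun x => θ₁ x - θ₂ x) ((p₂ x - p₁ x) * Real.sin (θ₂ x) ^ 2
      - (1 + p₁ x) * (Real.sin (θ₁ x - θ₂ x) * Real.sin (θ₁ x + θ₂ x))) x :=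
  ((h₁.2 x).sub (h₂.2 x)).congr_deriv (by rw [← sin_sq_sub_sin_sq]; ring)

theorem mul_sinc (x : ℝ) : x * Real.sinc x = Real.sin x := by
  by_cases hx : x = 0
  · simp [hx]
  · rw [Real.sinc_of_ne_zero hx, mul_div_cancel₀ _ hx]

/-- **Sturm comparison**: the larger the potential, the smaller the Prüfer angle. -/
theorem IsPruferAngle.lt_of_lt {p₁ p₂ θ₁ θ₂ : ℝ → ℝ} {t₀ : ℝ} (hp₁ : Continuous p₁)
    (hlt : ∀ x, 0 < x → p₁ x < p₂ x)
    (h₁ : IsPruferAngle p₁ t₀ θ₁) (h₂ : IsPruferAngle p₂ t₀ θ₂) {x : ℝ} (hx : 0 < x) :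
    θ₂ x < θ₁ x := by
  have hθ₁ := h₁.continuous
  have hθ₂ := h₂.continuous
  -- Writing sin d = d · sinc d for d = θ₁ - θ₂ gives a linear equation d' = h + g d with g
  -- continuous and h = (p₂ - p₁) sin² θ₂ ≥ 0; an integrating factor then makes F monotone.
  set g : ℝ → ℝ := fun x => -((1 + p₁ x) * Real.sinc (θ₁ x - θ₂ x) * Real.sin (θ₁ x + θ₂ x))
    with hgdef
  have hg : Continuous g := by
    have := Real.continuous_sinc
    fun_prop
  set F : ℝ → ℝ := fun x => Real.exp (-∫ t in (0 : ℝ)..x, g t) * (θ₁ x - θ₂ x) with hF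
  have hFd : ∀ x, HasDerivAt F (Real.exp (-∫ t in (0 : ℝ)..x, g t) *
      ((p₂ x - p₁ x) * Real.sin (θ₂ x) ^ 2)) x := by
    intro x
    refine hasDerivAt_exp_neg_integral_mul (d := fun x => θ₁ x - θ₂ x)
      (h := fun x => (p₂ x - p₁ x) * Real.sin (θ₂ x) ^ 2) hg
      ((h₁.hasDerivAt_sub h₂ x).congr_deriv ?_)
    simp only [hgdef]
    rw [← mul_sinc (θ₁ x - θ₂ x)]
    ring
  have hmono : MonotoneOn F (Ici 0) := by
    refine monotoneOn_of_deriv_nonneg (convex_Ici 0)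
      (fun x _ => (hFd x).continuousAt.continuousWithinAt)
      (fun x _ => (hFd x).differentiableAt.differentiableWithinAt) fun x hx => ?_
    rw [interior_Ici, mem_Ioi] at hx
    rw [(hFd x).deriv]
    have := hlt x hx
    exact mul_nonneg (Real.exp_pos _).le (mul_nonneg (by linarith) (sq_nonneg _))
  have hF0 : F 0 = 0 := by simp [hF, h₁.1, h₂.1]
  have hFx : 0 ≤ F x := hF0 ▸ hmono (mem_Ici.2 le_rfl) (mem_Ici.2 hx.le) hx.le
  have hpos : 0 < F x := by
    -- If F x = 0, then F vanishes on (0, x), hence so does sin θ₂; differentiating gives cos θ₂ = 0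
    -- as well, which is absurd.
    refine lt_of_le_of_ne hFx fun h0 => ?_
    have hz : ∀ y ∈ Ioo 0 x, F y = 0 := by
      intro y hy
      refine le_antisymm ?_ ?_
      · rw [h0]; exact hmono (mem_Ici.2 hy.1.le) (mem_Ici.2 hx.le) hy.2.le
      · rw [← hF0]; exact hmono (mem_Ici.2 le_rfl) (mem_Ici.2 hy.1.le) hy.1.le
    have hs : ∀ y ∈ Ioo 0 x, Real.sin (θ₂ y) = 0 := by
      intro y hy
      have hev : F =ᶠ[nhds y] fun _ => 0 :=
        Filter.eventually_of_mem (Ioo_mem_nhds hy.1 hy.2) hz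
      have := (hFd y).unique ((hasDerivAt_const y (0 : ℝ)).congr_of_eventuallyEq hev)
      have hlt' := hlt y hy.1
      rcases mul_eq_zero.1 this with h | h
      · exact absurd h (Real.exp_pos _).ne'
      rcases mul_eq_zero.1 h with h | h
      · linarith
      · exact pow_eq_zero_iff (by norm_num) |>.1 h
    have hy : x / 2 ∈ Ioo 0 x := ⟨by linarith, by linarith⟩
    have hev : (fun y => Real.sin (θ₂ y)) =ᶠ[nhds (x / 2)] fun _ => 0 :=
      Filter.eventually_of_mem (Ioo_mem_nhds hy.1 hy.2) hs
    have := ((h₂.2 (x / 2)).sin).unique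
      ((hasDerivAt_const (x / 2) (0 : ℝ)).congr_of_eventuallyEq hev)
    rw [hs _ hy] at this
    have h1 := Real.sin_sq_add_cos_sq (θ₂ (x / 2))
    rw [hs _ hy] at h1
    norm_num at this
    rw [this] at h1
    norm_num at h1
  have := (mul_pos_iff_of_pos_left (Real.exp_pos _)).1 hpos
  linarith

/-- The Prüfer angle at a given point depends continuously on the spectral parameter. -/
theorem continuous_pruferAngle_parameter {q : ℝ → ℝ} (hq : Continuous q) {t₀ : ℝ}
    {θ : ℝ → ℝ → ℝ} (hθ : ∀ e, IsPruferAngle (fun x => q x - e) t₀ (θ e)) {x : ℝ} (hx : 0 ≤ x) :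
    Continuous fun e => θ e x := by
  refine continuous_iff_continuousAt.2 fun e => ?_
  obtain ⟨K, hK⟩ := exists_bound_Icc (p := fun x => q x - e) (by fun_prop) 0 x
  have hb : ∀ e', dist (θ e' x) (θ e x) ≤ gronwallBound 0 K |e' - e| x := by
    intro e'
    have := dist_le_of_approx_trajectories_ODE_of_mem (s := fun _ => univ) (K := K) (a := 0)
      (b := x) (δ := 0) (εf := |e' - e|) (εg := 0)
      (v := fun x y => 1 - (1 + (q x - e)) * Real.sin y ^ 2) (f := θ e') (g := θ e)
      (fun y hy => (lipschitzWith_pruferField (hK y (Ico_subset_Icc_self hy))).lipschitzOnWith)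
      (hθ e').continuous.continuousOn (fun y _ => ((hθ e').2 y).hasDerivWithinAt) ?_
      (fun _ _ => trivial)
      (hθ e).continuous.continuousOn (fun y _ => ((hθ e).2 y).hasDerivWithinAt)
      (fun y _ => by simp) (fun _ _ => trivial) (by rw [(hθ e').1, (hθ e).1, dist_self]) x ⟨hx, le_rfl⟩
    · simpa using this
    · intro y _
      rw [Real.dist_eq]
      have : 1 - (1 + (q y - e')) * Real.sin (θ e' y) ^ 2
          - (1 - (1 + (q y - e)) * Real.sin (θ e' y) ^ 2)
          = (e' - e) * Real.sin (θ e' y) ^ 2 := by ring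
      rw [this, abs_mul, abs_of_nonneg (sq_nonneg (Real.sin (θ e' y)))]
      exact mul_le_of_le_one_right (abs_nonneg _) (Real.sin_sq_le_one _)
  refine tendsto_iff_dist_tendsto_zero.2 (squeeze_zero (fun _ => dist_nonneg) hb ?_)
  have hc : Continuous fun e' => gronwallBound 0 K |e' - e| x :=
    (gronwallBound_continuous_ε 0 K x).comp (by fun_prop)
  have := hc.tendsto e
  rwa [sub_self, abs_zero, gronwallBound_ε0_δ0] at this

/-! ### Behaviour of the angle at infinity -/

/-- The Prüfer angle `θ` eventually stays in the sector `(jπ - π/2, jπ)`, where `f` and `f'` have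
opposite signs. -/
def EventuallyInSector (θ : ℝ → ℝ) (j : ℕ) : Prop :=
  ∀ᶠ x in Filter.atTop, θ x ∈ Ioo (j * Real.pi - Real.pi / 2) (j * Real.pi)

theorem EventuallyInSector.tendsto {p θ : ℝ → ℝ} {t₀ : ℝ} {j : ℕ} (h : IsPruferAngle p t₀ θ)
    (htop : Filter.Tendsto p Filter.atTop Filter.atTop) (hj : EventuallyInSector θ j) :
    Filter.Tendsto θ Filter.atTop (nhds (j * Real.pi)) := by
  have key : ∀ ε : ℝ, 0 < ε → ε < Real.pi / 2 →
      ∀ᶠ x in Filter.atTop, (j : ℝ) * Real.pi - ε < θ x := by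
    intro ε hε hε2
    have hs : 0 < Real.sin ε := Real.sin_pos_of_pos_of_lt_pi hε (by linarith [Real.pi_pos])
    -- With p ≥ 2 / sin² ε, θ' ≤ -1 wherever sin² θ ≥ sin² ε. An angle once at or below jπ - ε stays
    -- below it and falls by at least π over a length π, leaving a sector of width π/2.
    obtain ⟨X, hX⟩ := Filter.eventually_atTop.1
      (hj.and (htop.eventually_ge_atTop (2 / Real.sin ε ^ 2)))
    refine Filter.eventually_atTop.2 ⟨X, fun x hx => ?_⟩
    by_contra! hcon
    have hp : ∀ y, x ≤ y → ∀ t, Real.sin ε ^ 2 ≤ t → 1 - (1 + p y) * t ≤ -1 := by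
      intro y hy t ht
      have h1 := (hX y (hx.trans hy)).2
      rw [div_le_iff₀ (by positivity)] at h1
      have h3 : 0 < p y := lt_of_lt_of_le (by positivity) (hX y (hx.trans hy)).2
      nlinarith [mul_le_mul_of_nonneg_left ht h3.le, sq_nonneg (Real.sin ε)]
    have hlt : ∀ y, x < y → θ y < j * Real.pi - ε := fun y hy =>
      lt_of_deriv_neg_of_eq h.2 hcon (fun z hz hz' => by
        rw [hz', sin_sq_nat_mul_pi_sub]
        linarith [hp z hz _ le_rfl]) hy
    have hd : ∀ y, x < y → deriv θ y ≤ -1 := by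
      intro y hy
      rw [(h.2 y).deriv]
      refine hp y hy.le _ ?_
      have h1 := hlt y hy
      have h2 := (hX y (hx.trans hy.le)).1.1
      have h3 : Real.sin ε ≤ Real.sin (j * Real.pi - θ y) :=
        Real.sin_le_sin_of_le_of_le_pi_div_two (by linarith) (by linarith) (by linarith)
      have h4 := sin_sq_nat_mul_pi_sub j (j * Real.pi - θ y)
      rw [sub_sub_cancel] at h4
      rw [h4]
      gcongr
    have hx2 : x ≤ x + Real.pi := by linarith [Real.pi_pos]
    have := (convex_Icc x (x + Real.pi)).image_sub_le_mul_sub_of_deriv_le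
      h.continuous.continuousOn (fun y _ => (h.2 y).differentiableAt.differentiableWithinAt)
      (C := -1) (fun y hy => hd y (by rw [interior_Icc] at hy; exact hy.1)) x (left_mem_Icc.2 hx2)
      (x + Real.pi) (right_mem_Icc.2 hx2) hx2
    have h5 := (hX (x + Real.pi) (hx.trans hx2)).1.1
    linarith [Real.pi_pos]
  refine (tendsto_order.2 ⟨fun a ha => ?_, fun a ha => ?_⟩)
  · have hpi := Real.pi_pos
    have h1 : 0 < min ((j : ℝ) * Real.pi - a) (Real.pi / 4) := lt_min (by linarith) (by linarith)
    filter_upwards [key _ h1 (by linarith [min_le_right ((j : ℝ) * Real.pi - a) (Real.pi / 4)])]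
      with x hx
    linarith [min_le_left ((j : ℝ) * Real.pi - a) (Real.pi / 4)]
  · filter_upwards [hj] with x hx
    exact hx.2.trans ha

/-- In a common sector sin(θ₁ - θ₂) ≥ 0 ≥ sin(θ₁ + θ₂), so the difference, positive by comparison,
is eventually nondecreasing. Both angles tend to jπ, so it would also tend to 0. -/
theorem not_eventuallyInSector_of_lt {p₁ p₂ θ₁ θ₂ : ℝ → ℝ} {t₀ : ℝ} {j : ℕ} (hp₁ : Continuous p₁)
    (hlt : ∀ x, 0 < x → p₁ x < p₂ x)
    (h₁ : IsPruferAngle p₁ t₀ θ₁) (h₂ : IsPruferAngle p₂ t₀ θ₂)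
    (ht₁ : Filter.Tendsto p₁ Filter.atTop Filter.atTop)
    (ht₂ : Filter.Tendsto p₂ Filter.atTop Filter.atTop)
    (hj₁ : EventuallyInSector θ₁ j) : ¬ EventuallyInSector θ₂ j := by
  intro hj₂
  obtain ⟨X, hX⟩ := Filter.eventually_atTop.1
    ((hj₁.and hj₂).and ((ht₁.eventually_ge_atTop 0).and (Filter.eventually_gt_atTop 0)))
  have hpos : ∀ x, X ≤ x → 0 < θ₁ x - θ₂ x := fun x hx =>
    sub_pos.2 (h₁.lt_of_lt hp₁ hlt h₂ (hX x hx).2.2)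
  have hmono : MonotoneOn (fun x => θ₁ x - θ₂ x) (Ici X) := by
    refine monotoneOn_of_deriv_nonneg (convex_Ici X)
      (fun x _ => (h₁.hasDerivAt_sub h₂ x).continuousAt.continuousWithinAt)
      (fun x _ => (h₁.hasDerivAt_sub h₂ x).differentiableAt.differentiableWithinAt) fun x hx => ?_
    rw [interior_Ici, mem_Ioi] at hx
    rw [(h₁.hasDerivAt_sub h₂ x).deriv]
    obtain ⟨⟨hx1, hx2⟩, hx3, hx4⟩ := hX x hx.le
    have hd := hpos x hx.le
    have hpi := Real.pi_pos
    have hs1 : 0 ≤ Real.sin (θ₁ x - θ₂ x) :=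
      Real.sin_nonneg_of_nonneg_of_le_pi hd.le (by linarith [hx1.2, hx2.1])
    have hs2 : Real.sin (θ₁ x + θ₂ x) ≤ 0 := by
      have : Real.sin (θ₁ x + θ₂ x) = Real.sin (θ₁ x + θ₂ x - j * (2 * Real.pi)) :=
        (Real.sin_sub_nat_mul_two_pi _ _).symm
      rw [this]
      exact Real.sin_nonpos_of_nonpos_of_neg_pi_le (by linarith [hx1.2, hx2.2])
        (by linarith [hx1.1, hx2.1])
    have h3 : 0 ≤ (p₂ x - p₁ x) * Real.sin (θ₂ x) ^ 2 :=
      mul_nonneg (by linarith [hlt x hx4]) (sq_nonneg _)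
    have h4 : (1 + p₁ x) * (Real.sin (θ₁ x - θ₂ x) * Real.sin (θ₁ x + θ₂ x)) ≤ 0 :=
      mul_nonpos_of_nonneg_of_nonpos (by linarith) (mul_nonpos_of_nonneg_of_nonpos hs1 hs2)
    linarith
  have hlim := (hj₁.tendsto h₁ ht₁).sub (hj₂.tendsto h₂ ht₂)
  rw [sub_self] at hlim
  have : θ₁ X - θ₂ X ≤ 0 := ge_of_tendsto hlim <| by
    filter_upwards [Filter.eventually_ge_atTop X] with x hx
    exact hmono (mem_Ici.2 le_rfl) (mem_Ici.2 hx) hx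
  linarith [hpos X le_rfl]

/-- The condition keeps θ off the multiples of π/2, so by continuity it is trapped between two
consecutive ones. As t₀ ≥ 0 forces θ > 0, the sector index is at least 1. -/
theorem exists_eventuallyInSector_of_sin_neg {p θ : ℝ → ℝ} {t₀ : ℝ} (h0 : 0 ≤ t₀)
    (h : IsPruferAngle p t₀ θ) (hs : ∀ᶠ x in Filter.atTop, Real.sin (2 * θ x) < 0) :
    ∃ n : ℕ, EventuallyInSector θ (n + 1) := by
  obtain ⟨X, hX⟩ := Filter.eventually_atTop.1 (hs.and (Filter.eventually_gt_atTop 0))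
  have hpos : 0 < θ X := by
    have := h.lt_of_le 0 (a := 0) (by rw [h.1]; simpa using h0) (hX X le_rfl).2
    simpa using this
  have hpi := Real.pi_pos
  set n := ⌊θ X / Real.pi⌋₊ with hn
  have hn1 : n * Real.pi ≤ θ X := by
    have := Nat.floor_le (div_pos hpos hpi).le
    rwa [le_div_iff₀ hpi] at this
  have hn2 : θ X < (n + 1) * Real.pi := by
    have := Nat.lt_floor_add_one (θ X / Real.pi)
    rwa [div_lt_iff₀ hpi] at this
  have hsX := (hX X le_rfl).1
  have hn3 : n * Real.pi + Real.pi / 2 < θ X := by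
    by_contra! hcon
    have : 0 ≤ Real.sin (2 * θ X - n * (2 * Real.pi)) :=
      Real.sin_nonneg_of_nonneg_of_le_pi (by linarith) (by linarith)
    rw [Real.sin_sub_nat_mul_two_pi] at this
    linarith
  have havoid : ∀ c : ℝ, Real.sin (2 * c) = 0 → ∀ x, X ≤ x → θ x ≠ c := by
    intro c hc x hx hxc
    have := (hX x hx).1
    rw [hxc, hc] at this
    exact lt_irrefl _ this
  have hs1 : Real.sin (2 * ((n : ℝ) * Real.pi + Real.pi / 2)) = 0 := by
    have : 2 * ((n : ℝ) * Real.pi + Real.pi / 2) = ((2 * n + 1 : ℕ) : ℝ) * Real.pi := by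
      push_cast; ring
    rw [this, Real.sin_nat_mul_pi]
  have hs2 : Real.sin (2 * (((n : ℝ) + 1) * Real.pi)) = 0 := by
    have : 2 * (((n : ℝ) + 1) * Real.pi) = ((2 * n + 2 : ℕ) : ℝ) * Real.pi := by
      push_cast; ring
    rw [this, Real.sin_nat_mul_pi]
  refine ⟨n, Filter.eventually_atTop.2 ⟨X, fun x hx => ?_⟩⟩
  push_cast
  constructor
  · by_contra! hcon
    obtain ⟨y, hy, hy'⟩ := intermediate_value_Icc' hx h.continuous.continuousOn
      (show (n : ℝ) * Real.pi + Real.pi / 2 ∈ Icc (θ x) (θ X) from ⟨by linarith, hn3.le⟩)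
    exact havoid _ hs1 y hy.1 hy'
  · by_contra! hcon
    obtain ⟨y, hy, hy'⟩ := intermediate_value_Icc hx h.continuous.continuousOn
      (show ((n : ℝ) + 1) * Real.pi ∈ Icc (θ X) (θ x) from ⟨hn2.le, hcon⟩)
    exact havoid _ hs2 y hy.1 hy'

theorem EventuallyInSector.sin_neg {θ : ℝ → ℝ} {j : ℕ} (h : EventuallyInSector θ j) :
    ∀ᶠ x in Filter.atTop, Real.sin (2 * θ x) < 0 := by
  filter_upwards [h] with x hx
  rw [← Real.sin_sub_nat_mul_two_pi (2 * θ x) j]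
  exact Real.sin_neg_of_neg_of_neg_pi_lt (by linarith [hx.2]) (by linarith [hx.1])

theorem EventuallyInSector.eq {θ : ℝ → ℝ} {i j : ℕ} (hi : EventuallyInSector θ i)
    (hj : EventuallyInSector θ j) : i = j := by
  have key : ∀ {i j : ℕ}, EventuallyInSector θ i → EventuallyInSector θ j → j ≤ i := by
    intro i j hi hj
    obtain ⟨x, hxi, hxj⟩ := (hi.and hj).exists
    by_contra! hij
    have : (i : ℝ) + 1 ≤ j := by exact_mod_cast hij
    nlinarith [hxi.2, hxj.1, Real.pi_pos]
  exact le_antisymm (key hj hi) (key hi hj)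

/-! ### Eigenvalue levels defined by crossings -/

/-- The spectral parameters `e` for which the Prüfer angle of `-f'' + (q - e) f = 0` exceeds
`(n + 1)π` somewhere. -/
def crossingSet (q : ℝ → ℝ) (t₀ : ℝ) (n : ℕ) : Set ℝ :=
  {e | ∃ x, 0 ≤ x ∧ ((n : ℝ) + 1) * Real.pi < pruferAngle (fun y => q y - e) t₀ x}

/-- The `n`-th eigenvalue of `-f'' + q f` on `[0, ∞)`, defined through the Prüfer angle. -/
noncomputable def sturmLevel (q : ℝ → ℝ) (t₀ : ℝ) (n : ℕ) : ℝ := sInf (crossingSet q t₀ n)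

section Level

variable {q : ℝ → ℝ} {t₀ : ℝ}

theorem isPruferAngle_sub (hq : Continuous q) (t₀ e : ℝ) :
    IsPruferAngle (fun y => q y - e) t₀ (pruferAngle (fun y => q y - e) t₀) :=
  isPruferAngle_pruferAngle (by fun_prop) t₀

theorem tendsto_sub_atTop (htop : Filter.Tendsto q Filter.atTop Filter.atTop) (e : ℝ) :
    Filter.Tendsto (fun y => q y - e) Filter.atTop Filter.atTop := by
  simpa [sub_eq_add_neg] using Filter.tendsto_atTop_add_const_right _ (-e) htop

theorem crossingSet_subset_of_lt {q' : ℝ → ℝ} (hq : Continuous q) (hq' : Continuous q')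
    (hπ : t₀ < Real.pi) {e e' : ℝ} {n : ℕ} (hlt : ∀ x, 0 < x → q x - e < q' x - e')
    (he : e' ∈ crossingSet q' t₀ n) : e ∈ crossingSet q t₀ n := by
  obtain ⟨x, hx, hxe⟩ := he
  have hx0 : 0 < x := by
    refine lt_of_le_of_ne hx fun h => ?_
    rw [← h, (isPruferAngle_sub hq' t₀ e').1] at hxe
    have : 0 ≤ (n : ℝ) * Real.pi := by positivity
    linarith
  exact ⟨x, hx, hxe.trans ((isPruferAngle_sub hq t₀ e).lt_of_lt (by fun_prop) hlt
    (isPruferAngle_sub hq' t₀ e') hx0)⟩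

theorem mem_crossingSet_of_lt (hq : Continuous q) (hπ : t₀ < Real.pi) {e e' : ℝ} {n : ℕ}
    (he : e ∈ crossingSet q t₀ n) (hlt : e < e') : e' ∈ crossingSet q t₀ n :=
  crossingSet_subset_of_lt hq hq hπ (fun _ _ => by linarith) he

theorem crossingSet_succ_subset (n : ℕ) : crossingSet q t₀ (n + 1) ⊆ crossingSet q t₀ n := by
  rintro e ⟨x, hx, hxe⟩
  refine ⟨x, hx, lt_of_le_of_lt ?_ hxe⟩
  push_cast
  linarith [Real.pi_pos]

theorem crossingSet_nonempty (hq : Continuous q) (h0 : 0 ≤ t₀) (n : ℕ) :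
    (crossingSet q t₀ n).Nonempty := by
  set b := ((n : ℝ) + 1) * Real.pi + 1 with hb
  have hb0 : 0 ≤ b := by positivity
  obtain ⟨C, hC⟩ := isCompact_Icc.exists_bound_of_continuousOn (s := Icc 0 b) hq.continuousOn
  have h := isPruferAngle_sub hq t₀ (C + 1)
  -- With e = C + 1 one has 1 + q - e ≤ 0 on [0, b], so θ' ≥ 1 and θ gains at least b = (n + 1)π +
  -- 1.
  refine ⟨C + 1, b, hb0, ?_⟩
  have := (convex_Icc 0 b).mul_sub_le_image_sub_of_le_deriv
      h.continuous.continuousOn (fun y _ => (h.2 y).differentiableAt.differentiableWithinAt)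
      (C := 1) (fun y hy => ?_) 0 (left_mem_Icc.2 hb0) b (right_mem_Icc.2 hb0) hb0
  · rw [h.1] at this
    linarith
  · have h1 := hC y (interior_subset hy)
    rw [Real.norm_eq_abs] at h1
    have h2 := le_abs_self (q y)
    rw [(h.2 y).deriv]
    nlinarith [sq_nonneg (Real.sin (pruferAngle (fun y => q y - (C + 1)) t₀ y))]

theorem exists_lower_bound (hq : Continuous q)
    (htop : Filter.Tendsto q Filter.atTop Filter.atTop) :
    ∃ B, ∀ x, 0 ≤ x → B ≤ q x := by
  obtain ⟨X, hX⟩ := Filter.eventually_atTop.1 (htop.eventually_ge_atTop 0)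
  obtain ⟨C, hC⟩ := isCompact_Icc.exists_bound_of_continuousOn (s := Icc 0 X) hq.continuousOn
  refine ⟨min 0 (-C), fun x hx => ?_⟩
  rcases le_total X x with h | h
  · exact (min_le_left _ _).trans (hX x h)
  · exact (min_le_right _ _).trans (abs_le.1 (hC x ⟨hx, h⟩)).1

theorem crossingSet_bddBelow (hq : Continuous q)
    (htop : Filter.Tendsto q Filter.atTop Filter.atTop) (h0 : 0 ≤ t₀) (hπ : t₀ < Real.pi) (n : ℕ) :
    BddBelow (crossingSet q t₀ n) := by
  obtain ⟨B, hB⟩ := exists_lower_bound hq htop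
  -- The constant c is a barrier strictly between t₀ and π: for e very negative θ' < 0 at c, so the
  -- angle never reaches π.
  set c := (t₀ + Real.pi) / 2 with hc
  have hs : 0 < Real.sin c ^ 2 :=
    pow_pos (Real.sin_pos_of_pos_of_lt_pi (by linarith [Real.pi_pos]) (by linarith)) 2
  refine ⟨B - 2 / Real.sin c ^ 2, ?_⟩
  rintro e ⟨x, hx, hxe⟩
  by_contra! hcon
  have h := isPruferAngle_sub hq t₀ e
  have hpi : Real.pi ≤ ((n : ℝ) + 1) * Real.pi := by nlinarith [Real.pi_pos, n.cast_nonneg (α := ℝ)]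
  rcases hx.eq_or_lt with hx0 | hx0
  · rw [← hx0, h.1] at hxe
    linarith
  · have := lt_of_deriv_neg_of_eq h.2 (a := 0) (c := c) (by rw [h.1]; linarith)
      (fun y hy hyc => ?_) hx0
    · linarith
    · rw [hyc]
      have h2 : 2 / Real.sin c ^ 2 < q y - e := by linarith [hB y hy]
      rw [div_lt_iff₀ hs] at h2
      linarith

/-- The crossing set is open, by continuity of the angle in e, so it does not contain its infimum.
-/
theorem sturmLevel_notMem (hq : Continuous q)
    (htop : Filter.Tendsto q Filter.atTop Filter.atTop) (h0 : 0 ≤ t₀) (hπ : t₀ < Real.pi) (n : ℕ) :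
    sturmLevel q t₀ n ∉ crossingSet q t₀ n := by
  rintro ⟨x, hx, hxe⟩
  have hcont := continuous_pruferAngle_parameter hq (fun e => isPruferAngle_sub hq t₀ e) hx
  have hev : ∀ᶠ e in nhds (sturmLevel q t₀ n), e ∈ crossingSet q t₀ n := by
    filter_upwards [continuousAt_const.eventually_lt hcont.continuousAt hxe] with e he
    exact ⟨x, hx, he⟩
  obtain ⟨e, he, hlt⟩ := ((hev.filter_mono nhdsWithin_le_nhds).and
    (self_mem_nhdsWithin (s := Iio (sturmLevel q t₀ n)))).exists
  exact absurd (csInf_le (crossingSet_bddBelow hq htop h0 hπ n) he) (not_le.2 hlt)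

theorem mem_crossingSet_of_sturmLevel_lt (hq : Continuous q) (h0 : 0 ≤ t₀) (hπ : t₀ < Real.pi)
    {n : ℕ} {e : ℝ} (he : sturmLevel q t₀ n < e) : e ∈ crossingSet q t₀ n := by
  obtain ⟨a, ha, hae⟩ := exists_lt_of_csInf_lt (crossingSet_nonempty hq h0 n) he
  exact mem_crossingSet_of_lt hq hπ ha hae

/-- At the infimum the angle never exceeds (n + 1)π. If it fell to the bottom of the sector where q
> E + 1, the same would hold for slightly larger e; but those e do cross, and neither a crossing
before the fall nor one after it is compatible with the one-way barriers. -/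
theorem eventuallyInSector_sturmLevel (hq : Continuous q)
    (htop : Filter.Tendsto q Filter.atTop Filter.atTop) (h0 : 0 ≤ t₀) (hπ : t₀ < Real.pi) (n : ℕ) :
    EventuallyInSector (pruferAngle (fun y => q y - sturmLevel q t₀ n) t₀) (n + 1) := by
  set E := sturmLevel q t₀ n with hE
  have h := isPruferAngle_sub hq t₀ E
  obtain ⟨X, hX⟩ := Filter.eventually_atTop.1
    ((htop.eventually_gt_atTop (E + 1)).and (Filter.eventually_ge_atTop 0))
  have hle : ∀ x, 0 ≤ x → pruferAngle (fun y => q y - E) t₀ x ≤ ((n + 1 : ℕ) : ℝ) * Real.pi := by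
    intro x hx
    by_contra! hcon
    exact sturmLevel_notMem hq htop h0 hπ n ⟨x, hx, by push_cast at hcon; exact hcon⟩
  refine Filter.eventually_atTop.2 ⟨X, fun x hx => ⟨?_, ?_⟩⟩
  · by_contra! hcon
    -- Passing to x + 1 makes the inequality strict, hence stable under small changes of e; the
    -- margin in q > E + 1 keeps q - e > 0 for e < E + 1.
    have h1 := h.lt_of_pos (n + 1) (a := x) (x := x + 1)
      (fun y hy => by linarith [(hX y (hx.trans hy)).1]) hcon (by linarith)
    have hx0 : 0 ≤ x := (hX x hx).2
    have hcont := continuous_pruferAngle_parameter hq (fun e => isPruferAngle_sub hq t₀ e)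
      (show 0 ≤ x + 1 by linarith)
    have hev := hcont.continuousAt.eventually_lt continuousAt_const h1
    obtain ⟨e, ⟨he1, he2⟩, he3⟩ := (((hev.and (gt_mem_nhds (lt_add_one E))).filter_mono
      nhdsWithin_le_nhds).and (self_mem_nhdsWithin (s := Ioi E))).exists
    obtain ⟨y, hy, hye⟩ := mem_crossingSet_of_sturmLevel_lt hq h0 hπ he3
    have h2 := isPruferAngle_sub hq t₀ e
    have hpi := Real.pi_pos
    rcases lt_trichotomy y (x + 1) with hyx | hyx | hyx
    · have := h2.lt_of_le (n + 1) (a := y) (by push_cast; exact hye.le) hyx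
      linarith
    · rw [hyx] at hye
      push_cast at he1
      linarith
    · have := h2.lt_of_pos (n + 1)
        (fun z hz => by linarith [(hX z (by linarith)).1]) he1.le hyx
      push_cast at this
      linarith
  · refine lt_of_le_of_ne (hle x (hX x hx).2) fun heq => ?_
    have h1 := h.lt_of_le (n + 1) heq.ge (lt_add_one x)
    exact absurd (hle (x + 1) (by linarith [(hX x hx).2])) (not_le.2 h1)

theorem eq_sturmLevel (hq : Continuous q)
    (htop : Filter.Tendsto q Filter.atTop Filter.atTop) (h0 : 0 ≤ t₀) (hπ : t₀ < Real.pi) {n : ℕ}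
    {e : ℝ} (he : EventuallyInSector (pruferAngle (fun y => q y - e) t₀) (n + 1)) :
    e = sturmLevel q t₀ n := by
  have key : ∀ {a b : ℝ}, EventuallyInSector (pruferAngle (fun y => q y - a) t₀) (n + 1) →
      EventuallyInSector (pruferAngle (fun y => q y - b) t₀) (n + 1) → ¬ a < b := by
    intro a b ha hb hab
    exact not_eventuallyInSector_of_lt (p₁ := fun y => q y - b) (by fun_prop)
      (fun x _ => by linarith) (isPruferAngle_sub hq t₀ b) (isPruferAngle_sub hq t₀ a)
      (tendsto_sub_atTop htop b) (tendsto_sub_atTop htop a) hb ha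
  have hE := eventuallyInSector_sturmLevel hq htop h0 hπ n
  exact le_antisymm (not_lt.1 (key hE he)) (not_lt.1 (key he hE))

theorem strictMono_sturmLevel (hq : Continuous q)
    (htop : Filter.Tendsto q Filter.atTop Filter.atTop) (h0 : 0 ≤ t₀) (hπ : t₀ < Real.pi) :
    StrictMono (sturmLevel q t₀) := by
  refine strictMono_nat_of_lt_succ fun n => lt_of_le_of_ne ?_ fun heq => ?_
  · exact csInf_le_csInf (crossingSet_bddBelow hq htop h0 hπ n)
      (crossingSet_nonempty hq h0 (n + 1)) (crossingSet_succ_subset n)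
  -- Equal consecutive levels would place one and the same angle in two different sectors.
  · have h1 := eventuallyInSector_sturmLevel hq htop h0 hπ n
    rw [heq] at h1
    have := h1.eq (eventuallyInSector_sturmLevel hq htop h0 hπ (n + 1))
    omega

/-- Strict monotonicity of the eigenvalues in the potential. -/
theorem sturmLevel_lt_of_lt {q' : ℝ → ℝ} (hq : Continuous q) (hq' : Continuous q')
    (htop : Filter.Tendsto q Filter.atTop Filter.atTop)
    (htop' : Filter.Tendsto q' Filter.atTop Filter.atTop)
    (h0 : 0 ≤ t₀) (hπ : t₀ < Real.pi) (hlt : ∀ x, 0 < x → q x < q' x) (n : ℕ) :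
    sturmLevel q t₀ n < sturmLevel q' t₀ n := by
  refine lt_of_le_of_ne ?_ fun heq => ?_
  · exact csInf_le_csInf (crossingSet_bddBelow hq htop h0 hπ n)
      (crossingSet_nonempty hq' h0 n)
      fun e he => crossingSet_subset_of_lt hq hq' hπ (fun x hx => by linarith [hlt x hx]) he
  · have h1 := eventuallyInSector_sturmLevel hq htop h0 hπ n
    have h2 := eventuallyInSector_sturmLevel hq' htop' h0 hπ n
    rw [← heq] at h2
    exact not_eventuallyInSector_of_lt (by fun_prop) (fun x hx => by linarith [hlt x hx])
      (isPruferAngle_sub hq t₀ _) (isPruferAngle_sub hq' t₀ _)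
      (tendsto_sub_atTop htop _) (tendsto_sub_atTop htop' _) h1 h2

/-- The Prüfer angle eventually stays in the decaying sectors exactly at the levels. -/
theorem eventually_sin_neg_iff (hq : Continuous q)
    (htop : Filter.Tendsto q Filter.atTop Filter.atTop) (h0 : 0 ≤ t₀) (hπ : t₀ < Real.pi) {e : ℝ} :
    (∀ᶠ x in Filter.atTop, Real.sin (2 * pruferAngle (fun y => q y - e) t₀ x) < 0) ↔
      ∃ n, e = sturmLevel q t₀ n := by
  constructor
  · intro hs
    obtain ⟨n, hn⟩ := exists_eventuallyInSector_of_sin_neg h0 (isPruferAngle_sub hq t₀ e) hs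
    exact ⟨n, eq_sturmLevel hq htop h0 hπ hn⟩
  · rintro ⟨n, rfl⟩
    exact (eventuallyInSector_sturmLevel hq htop h0 hπ n).sin_neg

end Level

/-! ### From the angle back to the linear equation -/

/-- The Prüfer amplitude belonging to the Prüfer angle `θ` of `-f'' + p f = 0`. -/
noncomputable def pruferAmplitude (p θ : ℝ → ℝ) (x : ℝ) : ℝ :=
  Real.exp (∫ t in (0 : ℝ)..x, (1 + p t) * (Real.sin (θ t) * Real.cos (θ t)))

section Amplitude

variable {p θ : ℝ → ℝ} {t₀ : ℝ}

theorem pruferAmplitude_pos (p θ : ℝ → ℝ) (x : ℝ) : 0 < pruferAmplitude p θ x := Real.exp_pos _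

theorem pruferAmplitude_zero (p θ : ℝ → ℝ) : pruferAmplitude p θ 0 = 1 := by
  simp [pruferAmplitude]

theorem IsPruferAngle.hasDerivAt_amplitude (h : IsPruferAngle p t₀ θ) (hp : Continuous p) (x : ℝ) :
    HasDerivAt (pruferAmplitude p θ)
      (pruferAmplitude p θ x * ((1 + p x) * (Real.sin (θ x) * Real.cos (θ x)))) x := by
  have hθ := h.continuous
  have hg : Continuous fun t => (1 + p t) * (Real.sin (θ t) * Real.cos (θ t)) := by fun_prop
  exact (intervalIntegral.integral_hasDerivAt_right (hg.intervalIntegrable _ _)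
    (hg.stronglyMeasurableAtFilter _ _) hg.continuousAt).exp

theorem IsPruferAngle.hasDerivAt_mul_sin (h : IsPruferAngle p t₀ θ) (hp : Continuous p) (x : ℝ) :
    HasDerivAt (fun x => pruferAmplitude p θ x * Real.sin (θ x))
      (pruferAmplitude p θ x * Real.cos (θ x)) x := by
  refine ((h.hasDerivAt_amplitude hp x).mul (h.2 x).sin).congr_deriv ?_
  ring

theorem IsPruferAngle.hasDerivAt_mul_cos (h : IsPruferAngle p t₀ θ) (hp : Continuous p) (x : ℝ) :
    HasDerivAt (fun x => pruferAmplitude p θ x * Real.cos (θ x))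
      (p x * (pruferAmplitude p θ x * Real.sin (θ x))) x := by
  refine ((h.hasDerivAt_amplitude hp x).mul (h.2 x).cos).congr_deriv ?_
  have := Real.sin_sq_add_cos_sq (θ x)
  linear_combination (pruferAmplitude p θ x * Real.sin (θ x) * (1 + p x)) * this

end Amplitude

/-! ### Decay and growth of solutions -/

section Asymptotics

variable {p φ χ : ℝ → ℝ}

theorem hasDerivAt_sq_of_system (hφ : ∀ x, HasDerivAt φ (χ x) x) (x : ℝ) :
    HasDerivAt (fun x => φ x ^ 2) (2 * (φ x * χ x)) x :=
  ((hφ x).pow 2).congr_deriv (by push_cast; ring)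

theorem hasDerivAt_mul_of_system (hφ : ∀ x, HasDerivAt φ (χ x) x)
    (hχ : ∀ x, HasDerivAt χ (p x * φ x) x) (x : ℝ) :
    HasDerivAt (fun x => φ x * χ x) (χ x ^ 2 + p x * φ x ^ 2) x :=
  ((hφ x).mul (hχ x)).congr_deriv (by ring)

/-- A solution with `φ φ' < 0` eventually decays faster than any exponential. -/
theorem exists_sq_le_exp (hφ : ∀ x, HasDerivAt φ (χ x) x) (hχ : ∀ x, HasDerivAt χ (p x * φ x) x)
    (htop : Filter.Tendsto p Filter.atTop Filter.atTop)
    (hneg : ∀ᶠ x in Filter.atTop, φ x * χ x < 0) {M : ℝ} (hM : 0 < M) :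
    ∃ C X : ℝ, ∀ x, X ≤ x → φ x ^ 2 ≤ C * Real.exp (-(2 * M * x)) := by
  obtain ⟨X, hX⟩ := Filter.eventually_atTop.1 (hneg.and (htop.eventually_ge_atTop (2 * M ^ 2)))
  have hs := hasDerivAt_sq_of_system hφ
  have hP := hasDerivAt_mul_of_system hφ hχ
  have hanti : AntitoneOn (fun x => φ x ^ 2) (Ici X) := by
    refine antitoneOn_of_deriv_nonpos (convex_Ici X)
      (fun x _ => (hs x).continuousAt.continuousWithinAt)
      (fun x _ => (hs x).differentiableAt.differentiableWithinAt) fun x hx => ?_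
    rw [interior_Ici, mem_Ioi] at hx
    rw [(hs x).deriv]
    linarith [(hX x hx.le).1]
  -- The aim is φχ + Mφ² ≤ 0, that is, (φ²)' ≤ -2Mφ². Multiplied by exp(-Mx) this quantity is
  -- nondecreasing: for p ≥ 2M² the bracket is at least (χ + Mφ/2)² + (3/4)M²φ².
  have hz : ∀ x, HasDerivAt (fun x => Real.exp (-(M * x)) * (φ x * χ x + M * φ x ^ 2))
      (Real.exp (-(M * x)) * (χ x ^ 2 + M * (φ x * χ x) + (p x - M ^ 2) * φ x ^ 2)) x := by
    intro x
    have he : HasDerivAt (fun x => Real.exp (-(M * x))) (Real.exp (-(M * x)) * (-(M * 1))) x :=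
      ((hasDerivAt_id x).const_mul M).neg.exp
    refine (he.mul ((hP x).add ((hs x).const_mul M))).congr_deriv ?_
    simp only [Pi.add_apply]
    ring
  have hzmono : MonotoneOn (fun x => Real.exp (-(M * x)) * (φ x * χ x + M * φ x ^ 2)) (Ici X) := by
    refine monotoneOn_of_deriv_nonneg (convex_Ici X)
      (fun x _ => (hz x).continuousAt.continuousWithinAt)
      (fun x _ => (hz x).differentiableAt.differentiableWithinAt) fun x hx => ?_
    rw [interior_Ici, mem_Ioi] at hx
    rw [(hz x).deriv]
    refine mul_nonneg (Real.exp_pos _).le ?_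
    have h1 := (hX x hx.le).2
    nlinarith [sq_nonneg (χ x + M * φ x / 2), mul_nonneg (sub_nonneg.2 h1) (sq_nonneg (φ x)),
      sq_nonneg (M * φ x)]
  have hz0 : ∀ x, X ≤ x → φ x * χ x + M * φ x ^ 2 ≤ 0 := by
    intro x hx
    -- A positive value would force φχ + Mφ² to grow like exp(My), although it stays below Mφ(x)²
    -- because φχ < 0 and φ² decreases.
    by_contra! hcon
    set c := Real.exp (-(M * x)) * (φ x * χ x + M * φ x ^ 2) with hc
    have hc0 : 0 < c := mul_pos (Real.exp_pos _) hcon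
    have hlim : Filter.Tendsto (fun y => c * Real.exp (M * y)) Filter.atTop Filter.atTop :=
      (Real.tendsto_exp_atTop.comp (Filter.tendsto_id.const_mul_atTop hM)).const_mul_atTop hc0
    obtain ⟨y, hy, hxy⟩ := ((hlim.eventually_gt_atTop (M * φ x ^ 2)).and
      (Filter.eventually_ge_atTop x)).exists
    have hXy := hx.trans hxy
    have h1 : c ≤ Real.exp (-(M * y)) * (φ y * χ y + M * φ y ^ 2) :=
      hzmono (mem_Ici.2 hx) (mem_Ici.2 hXy) hxy
    have h2 : c * Real.exp (M * y) ≤ φ y * χ y + M * φ y ^ 2 := by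
      calc c * Real.exp (M * y)
          ≤ Real.exp (-(M * y)) * (φ y * χ y + M * φ y ^ 2) * Real.exp (M * y) := by gcongr
        _ = (Real.exp (-(M * y)) * Real.exp (M * y)) * (φ y * χ y + M * φ y ^ 2) := by ring
        _ = φ y * χ y + M * φ y ^ 2 := by
          rw [← Real.exp_add, neg_add_cancel, Real.exp_zero, one_mul]
    have h3 : φ y ^ 2 ≤ φ x ^ 2 := hanti (mem_Ici.2 hx) (mem_Ici.2 hXy) hxy
    nlinarith [(hX y hXy).1]
  have hw : ∀ x, HasDerivAt (fun x => Real.exp (2 * M * x) * φ x ^ 2)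
      (Real.exp (2 * M * x) * (2 * (φ x * χ x + M * φ x ^ 2))) x := by
    intro x
    have he : HasDerivAt (fun x => Real.exp (2 * M * x)) (Real.exp (2 * M * x) * (2 * M * 1)) x :=
      ((hasDerivAt_id x).const_mul (2 * M)).exp
    exact (he.mul (hs x)).congr_deriv (by ring)
  have hwanti : AntitoneOn (fun x => Real.exp (2 * M * x) * φ x ^ 2) (Ici X) := by
    refine antitoneOn_of_deriv_nonpos (convex_Ici X)
      (fun x _ => (hw x).continuousAt.continuousWithinAt)
      (fun x _ => (hw x).differentiableAt.differentiableWithinAt) fun x hx => ?_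
    rw [interior_Ici, mem_Ioi] at hx
    rw [(hw x).deriv]
    exact mul_nonpos_of_nonneg_of_nonpos (Real.exp_pos _).le (by linarith [hz0 x hx.le])
  refine ⟨Real.exp (2 * M * X) * φ X ^ 2, X, fun x hx => ?_⟩
  have h1 : Real.exp (2 * M * x) * φ x ^ 2 ≤ Real.exp (2 * M * X) * φ X ^ 2 :=
    hwanti (mem_Ici.2 le_rfl) (mem_Ici.2 hx) hx
  rw [Real.exp_neg, ← div_eq_mul_inv, le_div_iff₀ (Real.exp_pos _)]
  linarith

/-- A nontrivial solution without `φ φ' < 0` eventually stays away from `0`. -/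
theorem exists_le_sq (hφ : ∀ x, HasDerivAt φ (χ x) x) (hχ : ∀ x, HasDerivAt χ (p x * φ x) x)
    (htop : Filter.Tendsto p Filter.atTop Filter.atTop) (hne : ∀ x, φ x ≠ 0 ∨ χ x ≠ 0)
    (hneg : ¬ ∀ᶠ x in Filter.atTop, φ x * χ x < 0) :
    ∃ c X : ℝ, 0 < c ∧ ∀ x, X ≤ x → c ≤ φ x ^ 2 := by
  obtain ⟨X, hX⟩ := Filter.eventually_atTop.1 (htop.eventually_gt_atTop 0)
  have hs := hasDerivAt_sq_of_system hφ
  have hP := hasDerivAt_mul_of_system hφ hχ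
  rw [Filter.eventually_atTop] at hneg
  push Not at hneg
  obtain ⟨x₁, hx₁, hx₁'⟩ := hneg X
  -- (φχ)' = χ² + pφ² > 0, so once φχ is nonnegative it is positive from then on and φ² increases.
  have hP' : StrictMonoOn (fun x => φ x * χ x) (Ici X) := by
    refine strictMonoOn_of_deriv_pos (convex_Ici X)
      (fun x _ => (hP x).continuousAt.continuousWithinAt) fun x hx => ?_
    rw [interior_Ici, mem_Ioi] at hx
    rw [(hP x).deriv]
    have hpx := hX x hx.le
    rcases hne x with h | h
    · have := mul_pos hpx (sq_pos_of_ne_zero h)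
      positivity
    · have := mul_nonneg hpx.le (sq_nonneg (φ x))
      positivity
  have hpos : ∀ x, x₁ < x → 0 < φ x * χ x := fun x hx =>
    hx₁'.trans_lt (hP' (mem_Ici.2 hx₁) (mem_Ici.2 (hx₁.trans hx.le)) hx)
  have hmono : MonotoneOn (fun x => φ x ^ 2) (Ici x₁) := by
    refine monotoneOn_of_deriv_nonneg (convex_Ici x₁)
      (fun x _ => (hs x).continuousAt.continuousWithinAt)
      (fun x _ => (hs x).differentiableAt.differentiableWithinAt) fun x hx => ?_
    rw [interior_Ici, mem_Ioi] at hx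
    rw [(hs x).deriv]
    linarith [hpos x hx]
  -- At x₁ itself φ may vanish, so the lower bound is taken one unit later.
  refine ⟨φ (x₁ + 1) ^ 2, x₁ + 1, ?_, fun x hx => ?_⟩
  · exact sq_pos_of_ne_zero (left_ne_zero_of_mul (hpos (x₁ + 1) (lt_add_one _)).ne')
  · exact hmono (mem_Ici.2 (by linarith)) (mem_Ici.2 (by linarith)) hx

end Asymptotics

/-! ### Linear uniqueness and square-integrability criteria -/

/-- Uniqueness for the linear system `f' = g`, `g' = p f` on a half-line. -/
theorem eq_zero_of_linear_system {p : ℝ → ℝ} (hp : Continuous p) {a : ℝ} {f g : ℝ → ℂ}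
    (hf : ∀ u ∈ Ici a, HasDerivWithinAt f (g u) (Ici a) u)
    (hg : ∀ u ∈ Ici a, HasDerivWithinAt g (p u * f u) (Ici a) u)
    (hfa : f a = 0) (hga : g a = 0) {u : ℝ} (hu : a ≤ u) : f u = 0 := by
  obtain ⟨K, hK⟩ := isCompact_Icc.exists_bound_of_continuousOn (s := Icc a u) hp.continuousOn
  have hd : ∀ x ∈ Ici a, HasDerivWithinAt (fun x => (f x, g x)) (g x, p x * f x) (Ici a) x :=
    fun x hx => (hf x hx).prodMk (hg x hx)
  have := eq_zero_of_abs_deriv_le_mul_abs_self_of_eq_zero_right (K := max 1 K)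
    (f := fun x => (f x, g x)) (f' := fun x => (g x, p x * f x)) (a := a) (b := u)
    (fun x hx => (hd x hx.1).continuousWithinAt.mono Icc_subset_Ici_self)
    (fun x hx => (hd x hx.1).mono (Ici_subset_Ici.2 hx.1))
    (by simp [hfa, hga]) (fun x hx => ?_) u ⟨hu, le_rfl⟩
  · exact (Prod.ext_iff.1 this).1
  · have h1 : ‖((p x : ℝ) : ℂ)‖ ≤ K := by
      rw [Complex.norm_real]; exact hK x (Ico_subset_Icc_self hx)
    refine max_le ?_ ?_
    · calc ‖g x‖ ≤ 1 * ‖(f x, g x)‖ := by rw [one_mul]; exact norm_snd_le (f x, g x)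
        _ ≤ _ := by gcongr; exact le_max_left _ _
    · change ‖(p x : ℂ) * f x‖ ≤ _
      rw [norm_mul]
      exact mul_le_mul (h1.trans (le_max_right _ _)) (norm_fst_le (f x, g x)) (norm_nonneg _)
        (zero_le_one.trans (le_max_left _ _))

theorem isHalfLineL2_of_sq_le_exp {u₀ b C X : ℝ} (hb : 0 < b) {G : ℝ → ℂ} (hG : Continuous G)
    (h : ∀ u, X ≤ u → ‖G u‖ ^ 2 ≤ C * Real.exp (-b * u)) : IsHalfLineL2 u₀ G := by
  rw [IsHalfLineL2, memLp_two_iff_integrable_sq_norm hG.aestronglyMeasurable]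
  have : IntegrableOn (fun u => ‖G u‖ ^ 2) (Ioi u₀) := by
    refine integrable_of_isBigO_exp_neg hb (by fun_prop) ?_
    refine Asymptotics.IsBigO.of_bound C ?_
    filter_upwards [Filter.eventually_ge_atTop X] with u hu
    rw [Real.norm_of_nonneg (by positivity), Real.norm_of_nonneg (Real.exp_pos _).le]
    exact h u hu
  exact (integrableOn_Ici_iff_integrableOn_Ioi (by simp)).2 this

theorem not_isHalfLineL2_of_le_sq {u₀ c X : ℝ} (hc : 0 < c) {G : ℝ → ℂ}
    (h : ∀ u, X ≤ u → c ≤ ‖G u‖ ^ 2) : ¬ IsHalfLineL2 u₀ G := by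
  intro hG
  have h1 : IntegrableOn (fun u => ‖G u‖ ^ 2) (Ici (max u₀ X)) :=
    IntegrableOn.mono_set ((memLp_two_iff_integrable_sq_norm hG.1).1 hG)
      (Ici_subset_Ici.2 (le_max_left _ _))
  have h2 : IntegrableOn (fun _ : ℝ => c) (Ici (max u₀ X)) := by
    refine Integrable.mono' h1 aestronglyMeasurable_const ?_
    filter_upwards [ae_restrict_mem measurableSet_Ici] with u hu
    rw [Real.norm_of_nonneg hc.le]
    exact h u ((le_max_right _ _).trans hu)
  rw [integrableOn_const_iff] at h2
  simp [hc.ne'] at h2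

/-! ### Growth of the Morse potential -/

theorem continuous_morsePotential (k : ℝ) : Continuous (morsePotential k) := by
  unfold morsePotential
  fun_prop

theorem tendsto_morsePotential (k : ℝ) :
    Filter.Tendsto (morsePotential k) Filter.atTop Filter.atTop := by
  have h : morsePotential k = fun u => Real.exp u * (1 / 4 * Real.exp u + k) := by
    funext u
    rw [morsePotential, two_mul, Real.exp_add]
    ring
  rw [h]
  exact Real.tendsto_exp_atTop.atTop_mul_atTop₀ (Filter.tendsto_atTop_add_const_right _ _
    (Real.tendsto_exp_atTop.const_mul_atTop (by norm_num)))

theorem abs_morsePotential_sub_le (k e : ℝ) {u : ℝ} (hu : 0 ≤ u) :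
    |morsePotential k u - e| ≤ (1 / 4 + |k| + |e|) * Real.exp (2 * u) := by
  have h1 : Real.exp u ≤ Real.exp (2 * u) := Real.exp_le_exp.2 (by linarith)
  have h2 : 1 ≤ Real.exp (2 * u) := Real.one_le_exp (by linarith)
  calc |morsePotential k u - e|
      ≤ |1 / 4 * Real.exp (2 * u)| + |k * Real.exp u| + |e| :=
        (abs_sub _ _).trans (by gcongr; exact abs_add_le _ _)
    _ = 1 / 4 * Real.exp (2 * u) + |k| * Real.exp u + |e| * 1 := by
        rw [abs_mul, abs_mul, abs_of_pos (Real.exp_pos _), abs_of_pos (Real.exp_pos _), mul_one]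
        norm_num
    _ ≤ 1 / 4 * Real.exp (2 * u) + |k| * Real.exp (2 * u) + |e| * Real.exp (2 * u) := by gcongr
    _ = _ := by ring

/-! ### One-sided derivatives and regularity of eigenfunctions -/

theorem halfLineDeriv_eq {u₀ : ℝ} {f g : ℝ → ℂ}
    (h : ∀ u ∈ Ici u₀, HasDerivWithinAt f (g u) (Ici u₀) u) :
    EqOn (halfLineDeriv u₀ f) g (Ici u₀) :=
  fun u hu => (h u hu).derivWithin (uniqueDiffOn_Ici u₀ u hu)

theorem halfLineDeriv_congr {u₀ : ℝ} {f g : ℝ → ℂ} (h : EqOn f g (Ici u₀)) :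
    EqOn (halfLineDeriv u₀ f) (halfLineDeriv u₀ g) (Ici u₀) :=
  fun _ hu => derivWithin_congr h (h hu)

theorem ae_restrict_Ici_of_eqOn {u₀ : ℝ} {f g : ℝ → ℂ} (h : EqOn f g (Ici u₀)) :
    f =ᵐ[volume.restrict (Ici u₀)] g :=
  ae_restrict_of_forall_mem measurableSet_Ici h

/-- The derivative of an eigenfunction solves the eigenvalue equation everywhere, since it is
absolutely continuous with an almost everywhere derivative that is continuous. -/
theorem InMorseDomain.hasDerivWithinAt_halfLineDeriv {α u₀ k E : ℝ} {f : ℝ → ℂ}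
    (hf : InMorseDomain α u₀ k f)
    (hE : morseExpr u₀ k f =ᵐ[volume.restrict (Ici u₀)] fun u => (E : ℂ) * f u) :
    ∀ u ∈ Ici u₀, HasDerivWithinAt (halfLineDeriv u₀ f)
      (((morsePotential k u - E : ℝ) : ℂ) * f u) (Ici u₀) u := by
  set g := halfLineDeriv u₀ f with hg
  -- Freezing f at its endpoint value to the left of u₀ makes F continuous on the whole line, so its
  -- primitive is C¹.
  set F : ℝ → ℂ := fun u => ((morsePotential k u - E : ℝ) : ℂ) * f (max u₀ u) with hF
  have hFc : Continuous F := by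
    have h1 : Continuous fun u => f (max u₀ u) :=
      hf.contDiffOn.continuousOn.comp_continuous (by fun_prop) fun u =>
        mem_Ici.2 (le_max_left u₀ u)
    exact (Complex.continuous_ofReal.comp
      ((continuous_morsePotential k).sub continuous_const)).mul h1
  set G : ℝ → ℂ := fun u => ∫ t in u₀..u, F t with hG
  have hGd : ∀ u, HasDerivAt G (F u) u := fun u =>
    intervalIntegral.integral_hasDerivAt_right (hFc.intervalIntegrable _ _)
      (hFc.stronglyMeasurableAtFilter _ _) hFc.continuousAt
  have hG1 : ContDiff ℝ 1 G := by
    rw [contDiff_one_iff_deriv]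
    refine ⟨fun u => (hGd u).differentiableAt, ?_⟩
    rwa [funext fun u => (hGd u).deriv]
  have hae : ∀ᵐ u, u ∈ Ici u₀ → halfLineDeriv u₀ g u = F u := by
    have := (ae_restrict_iff' measurableSet_Ici).1 hE
    filter_upwards [this] with u hu hu0
    have h1 := hu hu0
    simp only [morseExpr] at h1
    simp only [hF, max_eq_right (mem_Ici.1 hu0)]
    push_cast
    linear_combination -h1
  have hconst : ∀ b, u₀ ≤ b → g b = G b + g u₀ := by
    intro b hb
    have hac : AbsolutelyContinuousOnInterval (g - G) u₀ b :=
      (hf.deriv_ac b hb).sub hG1.contDiffOn.absolutelyContinuousOnInterval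
    obtain ⟨C, hC⟩ := hac.const_of_ae_hasDerivAt_zero (by
      filter_upwards [hae, (hf.deriv_ac b hb).boundedVariationOn.ae_differentiableAt_of_mem_uIcc,
        Measure.ae_ne volume u₀] with u hu1 hu2 hu3 hu4
      rw [uIcc_of_le hb] at hu2 hu4
      have hlt : u₀ < u := lt_of_le_of_ne hu4.1 hu3.symm
      have h1 : deriv g u = F u := by
        rw [← hu1 hu4.1, halfLineDeriv, derivWithin_of_mem_nhds (Ici_mem_nhds hlt)]
      have := (hu2 hu4).hasDerivAt.sub (hGd u)
      rwa [h1, sub_self] at this)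
    have h1 := hC u₀ left_mem_uIcc
    have h2 := hC b right_mem_uIcc
    have h3 : G u₀ = 0 := intervalIntegral.integral_same
    simp only [Pi.sub_apply, h3, sub_zero] at h1 h2
    rw [h1, ← h2]
    ring
  intro u hu
  have := ((hGd u).add_const (g u₀)).hasDerivWithinAt (s := Ici u₀)
  refine (this.congr (fun y hy => hconst y hy) (hconst u hu)).congr_deriv ?_
  simp only [hF, max_eq_right (mem_Ici.1 hu)]

/-! ### Eigenvalues of the operator are the Prüfer levels -/

section Bridge

variable {α u₀ k e t₀ : ℝ}

/-- The shifted potential on `[0, ∞)`. -/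
noncomputable def shiftedMorse (u₀ k x : ℝ) : ℝ := morsePotential k (u₀ + x)

theorem continuous_shiftedMorse (u₀ k : ℝ) : Continuous (shiftedMorse u₀ k) :=
  (continuous_morsePotential k).comp (by fun_prop)

theorem tendsto_shiftedMorse (u₀ k : ℝ) :
    Filter.Tendsto (shiftedMorse u₀ k) Filter.atTop Filter.atTop :=
  (tendsto_morsePotential k).comp (Filter.tendsto_atTop_add_const_left _ _ Filter.tendsto_id)

/-- The real solution of the eigenvalue equation that satisfies the boundary condition, and its
derivative. -/
theorem exists_regular_solution (u₀ k e t₀ : ℝ) :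
    ∃ φ χ : ℝ → ℝ, (∀ x, HasDerivAt φ (χ x) x) ∧
      (∀ x, HasDerivAt χ ((shiftedMorse u₀ k x - e) * φ x) x) ∧
      φ 0 = Real.sin t₀ ∧ χ 0 = Real.cos t₀ ∧ (∀ x, φ x ≠ 0 ∨ χ x ≠ 0) ∧
      ((∀ᶠ x in Filter.atTop, φ x * χ x < 0) ↔ ∀ᶠ x in Filter.atTop,
        Real.sin (2 * pruferAngle (fun y => shiftedMorse u₀ k y - e) t₀ x) < 0) := by
  have hq := continuous_shiftedMorse u₀ k
  have hp : Continuous fun y => shiftedMorse u₀ k y - e := by fun_prop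
  have h := isPruferAngle_sub hq t₀ e
  set θ := pruferAngle (fun y => shiftedMorse u₀ k y - e) t₀
  refine ⟨_, _, h.hasDerivAt_mul_sin hp, h.hasDerivAt_mul_cos hp, ?_, ?_, fun x => ?_, ?_⟩
  · simp [pruferAmplitude_zero, h.1]
  · simp [pruferAmplitude_zero, h.1]
  · have hr := (pruferAmplitude_pos (fun y => shiftedMorse u₀ k y - e) θ x).ne'
    by_contra! hcon
    have h1 := (mul_eq_zero.1 hcon.1).resolve_left hr
    have h2 := (mul_eq_zero.1 hcon.2).resolve_left hr
    have := Real.sin_sq_add_cos_sq (θ x)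
    rw [h1, h2] at this
    norm_num at this
  · refine Filter.eventually_congr (Filter.Eventually.of_forall fun x => ?_)
    have hr := pruferAmplitude_pos (fun y => shiftedMorse u₀ k y - e) θ x
    rw [Real.sin_two_mul]
    have h1 : pruferAmplitude (fun y => shiftedMorse u₀ k y - e) θ x * Real.sin (θ x) *
        (pruferAmplitude (fun y => shiftedMorse u₀ k y - e) θ x * Real.cos (θ x))
        = (pruferAmplitude (fun y => shiftedMorse u₀ k y - e) θ x ^ 2 / 2) *
          (2 * Real.sin (θ x) * Real.cos (θ x)) := by ring
    rw [h1]
    have hr2 : 0 < pruferAmplitude (fun y => shiftedMorse u₀ k y - e) θ x ^ 2 / 2 := by positivity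
    exact ⟨fun h => by by_contra hc; linarith [mul_nonneg hr2.le (not_lt.1 hc)],
      fun h => mul_neg_of_pos_of_neg hr2 h⟩

theorem hasDerivAt_ofReal_shift {φ φ' : ℝ → ℝ} (h : ∀ x, HasDerivAt φ (φ' x) x) (u₀ u : ℝ) :
    HasDerivAt (fun u => ((φ (u - u₀) : ℝ) : ℂ)) ((φ' (u - u₀) : ℝ) : ℂ) u :=
  ((h (u - u₀)).comp_sub_const u u₀).ofReal_comp

theorem isMorseEigenvalue_of_decay {φ χ : ℝ → ℝ} (hφ : ∀ x, HasDerivAt φ (χ x) x)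
    (hχ : ∀ x, HasDerivAt χ ((shiftedMorse u₀ k x - e) * φ x) x)
    (hbc : Real.cos α * φ 0 + Real.sin α * χ 0 = 0)
    (hneg : ∀ᶠ x in Filter.atTop, φ x * χ x < 0) : IsMorseEigenvalue α u₀ k e := by
  have hφc : Continuous φ := continuous_iff_continuousAt.2 fun x => (hφ x).continuousAt
  have hχc : Continuous χ := continuous_iff_continuousAt.2 fun x => (hχ x).continuousAt
  set f : ℝ → ℂ := fun u => ((φ (u - u₀) : ℝ) : ℂ) with hf
  set g : ℝ → ℂ := fun u => ((χ (u - u₀) : ℝ) : ℂ) with hg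
  set l : ℝ → ℂ := fun u => (((morsePotential k u - e) * φ (u - u₀) : ℝ) : ℂ) with hl
  have hfd : ∀ u, HasDerivAt f (g u) u := hasDerivAt_ofReal_shift hφ u₀
  have hgd : ∀ u, HasDerivAt g (l u) u := by
    intro u
    refine (hasDerivAt_ofReal_shift hχ u₀ u).congr_deriv ?_
    simp only [hl, shiftedMorse, add_sub_cancel]
  have hfc : Continuous f := by fun_prop
  have hgc : Continuous g := by fun_prop
  have hlc : Continuous l := by
    have := continuous_morsePotential k
    fun_prop
  have hf1 : ContDiff ℝ 1 f := by
    rw [contDiff_one_iff_deriv]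
    refine ⟨fun u => (hfd u).differentiableAt, ?_⟩
    rwa [funext fun u => (hfd u).deriv]
  have hg1 : ContDiff ℝ 1 g := by
    rw [contDiff_one_iff_deriv]
    refine ⟨fun u => (hgd u).differentiableAt, ?_⟩
    rwa [funext fun u => (hgd u).deriv]
  have hdf : EqOn (halfLineDeriv u₀ f) g (Ici u₀) :=
    halfLineDeriv_eq fun u _ => (hfd u).hasDerivWithinAt
  have hddf : EqOn (halfLineDeriv u₀ (halfLineDeriv u₀ f)) l (Ici u₀) :=
    (halfLineDeriv_congr hdf).trans (halfLineDeriv_eq fun u _ => (hgd u).hasDerivWithinAt)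
  have hexpr : EqOn (morseExpr u₀ k f) (fun u => (e : ℂ) * f u) (Ici u₀) := by
    intro u hu
    rw [morseExpr, hddf hu]
    simp only [hl, hf]
    push_cast
    ring
  -- The second derivative (V_k - e)φ must be square integrable. As (V_k - e)² = O(exp(4u)), the
  -- choice M = 3, giving φ² = O(exp(-6u)), leaves exp(-2u).
  obtain ⟨C, X, hCX⟩ := exists_sq_le_exp hφ hχ
    (tendsto_sub_atTop (tendsto_shiftedMorse u₀ k) e) hneg (M := 3) (by norm_num)
  have hdecay : ∀ u, X + u₀ ≤ u →
      φ (u - u₀) ^ 2 ≤ C * Real.exp (6 * u₀) * Real.exp (-6 * u) := by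
    intro u hu
    refine (hCX (u - u₀) (by linarith)).trans (le_of_eq ?_)
    rw [mul_assoc C, ← Real.exp_add]
    congr 2
    ring
  have hfL2 : IsHalfLineL2 u₀ f := by
    refine isHalfLineL2_of_sq_le_exp (b := 6) (X := X + u₀) (C := C * Real.exp (6 * u₀))
      (by norm_num) hfc fun u hu => ?_
    rw [hf, Complex.norm_real, Real.norm_eq_abs, sq_abs]
    exact hdecay u hu
  have hlL2 : IsHalfLineL2 u₀ l := by
    refine isHalfLineL2_of_sq_le_exp (b := 2) (X := max 0 (X + u₀))
      (C := (1 / 4 + |k| + |e|) ^ 2 * (C * Real.exp (6 * u₀))) (by norm_num) hlc fun u hu => ?_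
    have hu0 : 0 ≤ u := (le_max_left _ _).trans hu
    have hu1 : X + u₀ ≤ u := (le_max_right _ _).trans hu
    simp only [hl]
    rw [Complex.norm_real, Real.norm_eq_abs, sq_abs, mul_pow]
    have h1 : (morsePotential k u - e) ^ 2 ≤ ((1 / 4 + |k| + |e|) * Real.exp (2 * u)) ^ 2 :=
      sq_le_sq' (by linarith [(abs_le.1 (abs_morsePotential_sub_le k e hu0)).1])
        (abs_le.1 (abs_morsePotential_sub_le k e hu0)).2
    calc (morsePotential k u - e) ^ 2 * φ (u - u₀) ^ 2
        ≤ ((1 / 4 + |k| + |e|) * Real.exp (2 * u)) ^ 2 *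
          (C * Real.exp (6 * u₀) * Real.exp (-6 * u)) :=
          mul_le_mul h1 (hdecay u hu1) (sq_nonneg _) (sq_nonneg _)
      _ = (1 / 4 + |k| + |e|) ^ 2 * (C * Real.exp (6 * u₀)) *
          (Real.exp (2 * u) * Real.exp (2 * u) * Real.exp (-6 * u)) := by ring
      _ = _ := by
        rw [← Real.exp_add, ← Real.exp_add]
        congr 2
        ring
  refine ⟨f, ⟨hf1.contDiffOn, hfL2, fun b hb => ?_, ?_, ?_, ?_⟩, fun hzero => ?_,
    ae_restrict_Ici_of_eqOn hexpr⟩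
  · refine ContDiffOn.absolutelyContinuousOnInterval (hg1.contDiffOn.congr fun u hu => ?_)
    rw [uIcc_of_le hb] at hu
    exact hdf hu.1
  · exact hlL2.ae_eq (ae_restrict_Ici_of_eqOn hddf).symm
  · exact (hfL2.const_mul (e : ℂ)).ae_eq (ae_restrict_Ici_of_eqOn hexpr).symm
  · rw [hdf self_mem_Ici]
    simp only [hf, hg, sub_self]
    exact_mod_cast hbc
  · have h0 : EqOn f 0 (Ici u₀) := Measure.eqOn_of_ae_eq hzero hfc.continuousOn
      continuousOn_const (by rw [interior_Ici, closure_Ioi])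
    obtain ⟨x, hx, hx0⟩ := (hneg.and (Filter.eventually_ge_atTop 0)).exists
    have h1 := h0 (show u₀ + x ∈ Ici u₀ by simpa using hx0)
    simp only [hf, add_sub_cancel_left, Pi.zero_apply, Complex.ofReal_eq_zero] at h1
    rw [h1, zero_mul] at hx
    exact lt_irrefl _ hx

/-- By uniqueness an eigenfunction is a nonzero multiple of the regular solution; without φφ' < 0
eventually, that solution is bounded away from 0 and not in L². -/
theorem eventually_neg_of_isMorseEigenvalue {φ χ : ℝ → ℝ} (ht : Real.sin (α + t₀) = 0)
    (hφ : ∀ x, HasDerivAt φ (χ x) x)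
    (hχ : ∀ x, HasDerivAt χ ((shiftedMorse u₀ k x - e) * φ x) x)
    (hφ0 : φ 0 = Real.sin t₀) (hχ0 : χ 0 = Real.cos t₀) (hne : ∀ x, φ x ≠ 0 ∨ χ x ≠ 0)
    (he : IsMorseEigenvalue α u₀ k e) : ∀ᶠ x in Filter.atTop, φ x * χ x < 0 := by
  obtain ⟨f, hf, hf0, hfe⟩ := he
  by_contra hneg
  set g := halfLineDeriv u₀ f with hg
  have hgd := hf.hasDerivWithinAt_halfLineDeriv hfe
  have hfd : ∀ u ∈ Ici u₀, HasDerivWithinAt f (g u) (Ici u₀) u := fun u hu =>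
    (hf.contDiffOn.differentiableOn (by norm_num) u hu).hasDerivWithinAt
  -- The boundary condition makes (f, f') at u₀ parallel to the unit vector (sin t₀, cos t₀); c is
  -- the coefficient.
  set c : ℂ := f u₀ * Real.sin t₀ + g u₀ * Real.cos t₀ with hc
  have hbc : f u₀ * Real.cos t₀ - g u₀ * Real.sin t₀ = 0 := by
    have h1 : Real.cos t₀ = Real.cos (α + t₀) * Real.cos α := by
      have := Real.cos_sub (α + t₀) α
      rw [add_sub_cancel_left, ht] at this
      rw [this]; ring
    have h2 : Real.sin t₀ = -(Real.cos (α + t₀) * Real.sin α) := by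
      have := Real.sin_sub (α + t₀) α
      rw [add_sub_cancel_left, ht] at this
      rw [this]; ring
    have h3 := hf.boundary
    rw [h1, h2]
    simp only [Complex.ofReal_mul, Complex.ofReal_neg]
    linear_combination (Real.cos (α + t₀) : ℂ) * h3
  have hsq : (Real.sin t₀ : ℂ) ^ 2 + (Real.cos t₀ : ℂ) ^ 2 = 1 := by
    exact_mod_cast Real.sin_sq_add_cos_sq t₀
  have hEq : ∀ u, u₀ ≤ u → f u = c * (φ (u - u₀) : ℝ) := by
    intro u hu
    have := eq_zero_of_linear_system (p := fun u => morsePotential k u - e) (a := u₀)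
      (f := fun u => f u - c * (φ (u - u₀) : ℝ)) (g := fun u => g u - c * (χ (u - u₀) : ℝ))
      (by have := continuous_morsePotential k; fun_prop)
      (fun v hv => (hfd v hv).sub
        ((hasDerivAt_ofReal_shift hφ u₀ v).const_mul c).hasDerivWithinAt)
      (fun v hv => ((hgd v hv).sub
        ((hasDerivAt_ofReal_shift hχ u₀ v).const_mul c).hasDerivWithinAt).congr_deriv (by
          simp only [shiftedMorse, add_sub_cancel]
          push_cast
          ring)) ?_ ?_ hu
    · exact sub_eq_zero.1 this
    · simp only [sub_self, hφ0, hc]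
      linear_combination (-(f u₀)) * hsq + (Real.cos t₀ : ℂ) * hbc
    · simp only [sub_self, hχ0, hc]
      linear_combination (-(g u₀)) * hsq - (Real.sin t₀ : ℂ) * hbc
  have hc0 : c ≠ 0 := by
    intro h0
    refine hf0 (ae_restrict_Ici_of_eqOn fun u hu => ?_)
    rw [hEq u hu, h0, zero_mul, Pi.zero_apply]
  obtain ⟨d, X, hd, hX⟩ := exists_le_sq hφ hχ
    (tendsto_sub_atTop (tendsto_shiftedMorse u₀ k) e) hne hneg
  refine not_isHalfLineL2_of_le_sq (u₀ := u₀) (c := ‖c‖ ^ 2 * d) (X := max u₀ (X + u₀))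
    (by positivity) (fun u hu => ?_) hf.memL2
  rw [hEq u ((le_max_left _ _).trans hu), norm_mul, mul_pow, Complex.norm_real, Real.norm_eq_abs,
    sq_abs]
  have := hX (u - u₀) (by linarith [(le_max_right u₀ (X + u₀)).trans hu])
  gcongr

theorem isMorseEigenvalue_iff (ht : Real.sin (α + t₀) = 0) (h0 : 0 ≤ t₀) (hπ : t₀ < Real.pi) :
    IsMorseEigenvalue α u₀ k e ↔ ∃ n, e = sturmLevel (shiftedMorse u₀ k) t₀ n := by
  rw [← eventually_sin_neg_iff (continuous_shiftedMorse u₀ k) (tendsto_shiftedMorse u₀ k) h0 hπ]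
  obtain ⟨φ, χ, hφ, hχ, hφ0, hχ0, hne, hiff⟩ := exists_regular_solution u₀ k e t₀
  rw [← hiff]
  refine ⟨eventually_neg_of_isMorseEigenvalue ht hφ hχ hφ0 hχ0 hne,
    isMorseEigenvalue_of_decay hφ hχ ?_⟩
  rw [hφ0, hχ0, ← ht, Real.sin_add]
  ring

theorem isNthMorseEigenvalue_sturmLevel (ht : Real.sin (α + t₀) = 0) (h0 : 0 ≤ t₀)
    (hπ : t₀ < Real.pi) (n : ℕ) (u₀ k : ℝ) :
    IsNthMorseEigenvalue α n u₀ k (sturmLevel (shiftedMorse u₀ k) t₀ n) := by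
  have hmono := strictMono_sturmLevel (continuous_shiftedMorse u₀ k) (tendsto_shiftedMorse u₀ k)
    h0 hπ
  refine ⟨(isMorseEigenvalue_iff ht h0 hπ).2 ⟨n, rfl⟩, ?_⟩
  have : {E' : ℝ | IsMorseEigenvalue α u₀ k E' ∧ E' < sturmLevel (shiftedMorse u₀ k) t₀ n}
      = sturmLevel (shiftedMorse u₀ k) t₀ '' Iio n := by
    ext E'
    simp only [mem_ofPred_eq, isMorseEigenvalue_iff ht h0 hπ, mem_image, mem_Iio]
    constructor
    · rintro ⟨⟨m, rfl⟩, hm⟩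
      exact ⟨m, hmono.lt_iff_lt.1 hm, rfl⟩
    · rintro ⟨m, hm, rfl⟩
      exact ⟨⟨m, rfl⟩, hmono hm⟩
  rw [this, hmono.injective.encard_image, ← Finset.coe_Iio, encard_coe_eq_coe_finsetCard,
    Nat.card_Iio]

/-- The boundary condition for (sin t₀, cos t₀) reads sin(α + t₀) = 0, so t₀ is the representative
of -α modulo π in [0, π). -/
theorem exists_initial_angle (α : ℝ) :
    ∃ t₀, Real.sin (α + t₀) = 0 ∧ 0 ≤ t₀ ∧ t₀ < Real.pi := by
  obtain ⟨m, hm, -⟩ := existsUnique_add_zsmul_mem_Ico Real.pi_pos (-α) 0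
  rw [zero_add] at hm
  refine ⟨_, ?_, hm.1, hm.2⟩
  rw [add_neg_cancel_left, zsmul_eq_mul, Real.sin_int_mul_pi]

end Bridge

/-! ### Monotonicity of the potential and the main theorem -/

theorem morsePotential_lt_of_lt_left {k k' : ℝ} (h : k < k') (u : ℝ) :
    morsePotential k u < morsePotential k' u := by
  unfold morsePotential
  have := mul_lt_mul_of_pos_right h (Real.exp_pos u)
  linarith

/-- The Morse potential increases strictly where `e^u > -2k`. -/
theorem morsePotential_lt_of_lt {k u v : ℝ} (hu : -(2 * k) ≤ Real.exp u) (h : u < v) :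
    morsePotential k u < morsePotential k v := by
  unfold morsePotential
  have h1 : Real.exp u < Real.exp v := Real.exp_lt_exp.2 h
  have h2 : ∀ w : ℝ, Real.exp (2 * w) = Real.exp w ^ 2 := fun w => by
    rw [← Real.exp_nat_mul]; norm_num
  rw [h2, h2]
  -- V_k(v) - V_k(u) = (1/4)(e^v - e^u)(e^u + e^v + 4k), and both factors are positive.
  nlinarith [mul_pos (sub_pos.2 h1) (show 0 < Real.exp u + Real.exp v + 4 * k by linarith)]

theorem mainTheorem5 (α : ℝ) (n : ℕ) :
    (∀ u₀ k : ℝ, IsNthMorseEigenvalue α n u₀ k (morseEigenvalue α n u₀ k)) ∧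
    (∀ k : ℝ, 0 ≤ k → StrictMono fun u₀ : ℝ => morseEigenvalue α n u₀ k) ∧
    (∀ k : ℝ, k < 0 →
      StrictMonoOn (fun u₀ : ℝ => morseEigenvalue α n u₀ k) (Ici (Real.log (2 * |k|)))) ∧
    (∀ u₀ : ℝ, StrictMono fun k : ℝ => morseEigenvalue α n u₀ k) := by
  obtain ⟨t₀, ht, h0, hπ⟩ := exists_initial_angle α
  have hnth := isNthMorseEigenvalue_sturmLevel ht h0 hπ n
  have heq : ∀ u₀ k, morseEigenvalue α n u₀ k = sturmLevel (shiftedMorse u₀ k) t₀ n :=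
    fun u₀ k => (hnth u₀ k).eq_morseEigenvalue
  have hlt : ∀ u₀ k u₀' k', (∀ x, 0 < x → shiftedMorse u₀ k x < shiftedMorse u₀' k' x) →
      morseEigenvalue α n u₀ k < morseEigenvalue α n u₀' k' := by
    intro u₀ k u₀' k' h
    rw [heq, heq]
    exact sturmLevel_lt_of_lt (continuous_shiftedMorse _ _) (continuous_shiftedMorse _ _)
      (tendsto_shiftedMorse _ _) (tendsto_shiftedMorse _ _) h0 hπ h n
  refine ⟨fun u₀ k => by rw [heq]; exact hnth u₀ k, fun k hk a b hab => ?_,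
    fun k hk a ha b _ hab => ?_, fun u₀ a b hab => ?_⟩
  · exact hlt _ _ _ _ fun x _ => morsePotential_lt_of_lt
      (by linarith [Real.exp_pos (a + x)]) (by linarith)
  · refine hlt _ _ _ _ fun x hx => morsePotential_lt_of_lt ?_ (by linarith)
    -- The condition on the left endpoint a gives -2k ≤ e^a ≤ e^(a + x), so V_k increases along the
    -- whole half-line.
    rw [mem_Ici, Real.log_le_iff_le_exp (mul_pos two_pos (abs_pos.2 hk.ne)), abs_of_neg hk] at ha
    have := Real.exp_le_exp.2 (show a ≤ a + x by linarith)
    linarith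
  · exact hlt _ _ _ _ fun x _ => morsePotential_lt_of_lt_left hab _
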